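/- **Conventions.** Manifolds are smooth, finite-dimensional, Hausdorff and second countable, and are regarded as diffeological spaces whose plots are the smooth maps from Euclidean domains. Subsets, products, fibre products and quotients of diffeological spaces carry the subset, product, fibre-product and quotient diffeologies; "open" refers to the D-topology. A smooth map $f\colon X\to Y$ of diffeological spaces is a *local subduction* if for every plot $\phi\colon U\to Y$, $u\in U$ and $x\in X$ with $\phi(u)=f(x)$ there are an open neighbourhood $V\subset U$ of $u$ and a plot $\tilde\phi\colon V\to X$ with $\tilde\phi(u)=x$ and $f\circ\tilde\phi=\phi|_V$. A subset is *totally disconnected* if its subset diffeology is discrete, i.e. every plot with values in it is locally constant. A map $\pi\colon X\to Y$ is *quasi-étale* if it is a local subduction, its fibres are totally disconnected, and every smooth $f\colon\mathcal O\to X$ with $\mathcal O\subset X$ open and $\pi\circ f=\pi|_{\mathcal O}$ is a local diffeomorphism. A diffeological space $X$ is *quasi-étale* if every point of $X$ lies in the image of a quasi-étale map from a manifold to $X$; $\mathbf{QUED}$ is the full subcategory of diffeological spaces on these. A morphism $p\colon X\to Z$ of $\mathbf{QUED}$ is a *$\mathbf{QUED}$-submersion* if it is a local subduction and for every morphism $f\colon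 Y\to Z$ of $\mathbf{QUED}$ either the fibre product of $p$ and $f$ exists in $\mathbf{QUED}$ or there is no commutative square over $p$ and $f$ in $\mathbf{QUED}$. A *singular Lie groupoid* is a groupoid $\mathcal G\rightrightarrows M$ where $\mathcal G$ is a quasi-étale diffeological space, $M$ is a manifold, the source and target maps are $\mathbf{QUED}$-submersions, and the unit, multiplication and inverse maps are smooth. A *Lie groupoid* is a groupoid whose arrows and objects form manifolds, with smooth structure maps and with source and target submersions. **Lemma.** Let $\widetilde{\mathcal G}\rightrightarrows M$ be a Lie groupoid with source $s$ and target $t$, and let $\mathcal N\subset\widetilde{\mathcal G}$ be a wide normal subgroupoid (it contains all units, is closed under products and inverses, and $gng^{-1}\in\mathcal N$ for every isotropy arrow $n\in\mathcal N$ at the source of $g\in\widetilde{\mathcal G}$), equipped with the subset diffeology. Suppose that (a) $\mathcal N$ consists of isotropy arrows, i.e. $s|_{\mathcal N}=t|_{\mathcal N}$; (b) the map $s|_{\mathcal N}\colon\mathcal N\to M$ is a local subduction; (c) for each $x\in M$ the fibre $s^{-1}(x)\cap\mathcal N$ is totally disconnected in $\widetilde{\mathcal G}$. Then $\widetilde{\mathcal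 G}/\mathcal N\rightrightarrows M$, the set of cosets $g\mathcal N$ with the quotient diffeology and the groupoid structure induced from $\widetilde{\mathcal G}$, is a singular Lie groupoid. -/

import Mathlib

open Diffeology
open scoped Manifold ContDiff Topology

universe u v w

noncomputable section

/-! ### Diffeologies

We use Mathlib's `DiffeologicalSpace`, whose plots have domain all of `ℝⁿ`. This is equivalent to
using plots on open subsets of `ℝⁿ`: every point of an open set `V` has a neighbourhood on which the
identity agrees with a smooth map `ℝⁿ → V`. -/

section Diffeologies

/-- The subset diffeology. -/
instance subsetDiffeology {X : Type u} [DiffeologicalSpace X] (P : X → Prop) :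
    DiffeologicalSpace {x : X // P x} where
  plots _ := {p | IsPlot fun z => (p z : X)}
  constant_plots x := isPlot_const (x := (x : X))
  plot_reparam {_ _ p f} hp hf := isPlot_reparam (p := fun z => (p z : X)) hp hf
  locality {_ p} h := DiffeologicalSpace.locality (p := fun z => (p z : X)) h

/-- The product diffeology. -/
instance productDiffeology {X : Type u} {Y : Type v} [DiffeologicalSpace X]
    [DiffeologicalSpace Y] : DiffeologicalSpace (X × Y) where
  plots _ := {p | IsPlot (fun z => (p z).1) ∧ IsPlot (fun z => (p z).2)}
  constant_plots x := ⟨isPlot_const (x := x.1), isPlot_const (x := x.2)⟩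
  plot_reparam {_ _ p f} hp hf :=
    ⟨isPlot_reparam (p := fun z => (p z).1) hp.1 hf, isPlot_reparam (p := fun z => (p z).2) hp.2 hf⟩
  locality {_ p} h := by
    constructor
    · refine DiffeologicalSpace.locality (p := fun z => (p z).1) fun x => ?_
      obtain ⟨U, hU, hx, H⟩ := h x
      exact ⟨U, hU, hx, fun hf hs => (H hf hs).1⟩
    · refine DiffeologicalSpace.locality (p := fun z => (p z).2) fun x => ?_
      obtain ⟨U, hU, hx, H⟩ := h x
      exact ⟨U, hU, hx, fun hf hs => (H hf hs).2⟩

/-- Near any point of an open subset of `ℝⁿ` the identity extends to a smooth map of `ℝⁿ` into that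
open subset. -/
theorem exists_smooth_retract {n : ℕ} {U : Set (EuclideanSpace ℝ (Fin n))} (hU : IsOpen U)
    {x : EuclideanSpace ℝ (Fin n)} (hx : x ∈ U) :
    ∃ ρ : EuclideanSpace ℝ (Fin n) → EuclideanSpace ℝ (Fin n), ContDiff ℝ ∞ ρ ∧ (∀ y, ρ y ∈ U) ∧
      ∃ V : Set (EuclideanSpace ℝ (Fin n)), IsOpen V ∧ x ∈ V ∧ ∀ y ∈ V, ρ y = y := by
  obtain ⟨ε, hε, hball⟩ := Metric.isOpen_iff.1 hU x hx
  let b : ContDiffBump x := ⟨ε / 2, ε, by positivity, by linarith⟩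
  refine ⟨fun y => x + b y • (y - x), ?_, ?_, Metric.ball x (ε / 2), Metric.isOpen_ball,
    Metric.mem_ball_self (by positivity), ?_⟩
  · exact contDiff_const.add (b.contDiff.smul (contDiff_id.sub contDiff_const))
  · intro y
    apply hball
    by_cases hy : y ∈ Metric.ball x ε
    · rw [Metric.mem_ball, dist_eq_norm] at hy ⊢
      rw [add_sub_cancel_left, norm_smul, Real.norm_of_nonneg b.nonneg]
      calc b y * ‖y - x‖ ≤ 1 * ‖y - x‖ := by gcongr; exact b.le_one
        _ < ε := by rwa [one_mul]
    · have : b y = 0 := b.zero_of_le_dist (by simpa using hy)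
      simpa [this] using hε
  · intro y hy
    have : b y = 1 := b.one_of_mem_closedBall (Metric.ball_subset_closedBall hy)
    simp [this]

/-- The quotient diffeology: the plots are the maps that lift locally to plots of `X`. -/
instance quotientDiffeology {X : Type u} [DiffeologicalSpace X] (r : Setoid X) :
    DiffeologicalSpace (Quotient r) where
  plots n := {p | ∀ z : EuclideanSpace ℝ (Fin n), ∃ V : Set (EuclideanSpace ℝ (Fin n)),
    IsOpen V ∧ z ∈ V ∧ ∃ q : EuclideanSpace ℝ (Fin n) → X, IsPlot q ∧
      ∀ y ∈ V, p y = Quotient.mk r (q y)}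
  constant_plots x z :=
    ⟨Set.univ, isOpen_univ, trivial, fun _ => x.out, isPlot_const, fun _ _ => x.out_eq.symm⟩
  plot_reparam {_ _ p f} hp hf z := by
    obtain ⟨V, hV, hz, q, hq, h⟩ := hp (f z)
    exact ⟨f ⁻¹' V, hV.preimage hf.continuous, hz, q ∘ f, isPlot_reparam hq hf,
      fun y hy => h (f y) hy⟩
  locality {_ p} hp z := by
    obtain ⟨U, hU, hz, h⟩ := hp z
    obtain ⟨ρ, hρ, hρU, W, hW, hzW, hρW⟩ := exists_smooth_retract hU hz
    obtain ⟨V, hV, hzV, q, hq, hpq⟩ := h hρU hρ z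
    refine ⟨V ∩ W, hV.inter hW, ⟨hzV, hzW⟩, q, hq, fun y hy => ?_⟩
    have := hpq y hy.1
    rwa [Function.comp_apply, hρW y hy.2] at this

variable {X : Type u} {Y : Type v} [DiffeologicalSpace X] [DiffeologicalSpace Y]

/-- A smooth map is a local subduction if plots of the target lift locally through every point of
the fibre. -/
def IsLocalSubduction (f : X → Y) : Prop :=
  DSmooth f ∧ ∀ (n : ℕ) (φ : EuclideanSpace ℝ (Fin n) → Y), IsPlot φ →
    ∀ (x : X) (z : EuclideanSpace ℝ (Fin n)), φ z = f x →
      ∃ V : Set (EuclideanSpace ℝ (Fin n)), IsOpen V ∧ z ∈ V ∧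
        ∃ ψ : EuclideanSpace ℝ (Fin n) → X, IsPlot ψ ∧ ψ z = x ∧ ∀ y ∈ V, φ y = f (ψ y)

/-- A subset is totally disconnected if its subset diffeology is discrete, i.e. all plots with
values in it are locally constant. -/
def IsDiffTotallyDisconnected (S : Set X) : Prop :=
  ∀ (n : ℕ) (p : EuclideanSpace ℝ (Fin n) → X), IsPlot p → (∀ z, p z ∈ S) → IsLocallyConstant p

/-- Local diffeomorphisms: every point has a D-open neighbourhood that is mapped diffeomorphically
(for the subset diffeologies) onto a D-open subset of the target. -/
def IsLocalDiffeo (f : X → Y) : Prop :=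
  ∀ x : X, ∃ (U : Set X) (V : Set Y), IsOpen[dTopology] U ∧ x ∈ U ∧
    IsOpen[dTopology] V ∧
    ∃ e : {a // a ∈ U} ≃ {b // b ∈ V}, DSmooth e ∧ DSmooth e.symm ∧ ∀ a, (e a : Y) = f a

/-- Quasi-étale maps. -/
structure IsQuasiEtale (π : X → Y) : Prop where
  localSubduction : IsLocalSubduction π
  fibers : ∀ y : Y, IsDiffTotallyDisconnected (π ⁻¹' {y})
  rigid : ∀ O : Set X, IsOpen[dTopology] O →
    ∀ f : {x // x ∈ O} → X, DSmooth f → (∀ x, π (f x) = π x) → IsLocalDiffeo f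

end Diffeologies

/-! ### Manifolds and quasi-étale diffeological spaces -/

/-- A structure of a finite-dimensional, Hausdorff, second countable smooth manifold on a set `X`
whose diffeology (smooth maps from Euclidean spaces) is the given one. -/
structure SmoothManifoldStructure (X : Type u) [DiffeologicalSpace X] where
  dim : ℕ
  [topology : TopologicalSpace X]
  [charted : ChartedSpace (EuclideanSpace ℝ (Fin dim)) X]
  [isManifold : IsManifold (𝓡 dim) ∞ X]
  [t2 : T2Space X]
  [secondCountable : SecondCountableTopology X]
  isPlot_iff : ∀ {m : ℕ} (p : EuclideanSpace ℝ (Fin m) → X),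
    IsPlot p ↔ ContMDiff (𝓡 m) (𝓡 dim) ∞ p

/-- A diffeological space is a smooth manifold if its diffeology is that of a smooth manifold. -/
def IsSmoothManifold (X : Type u) [DiffeologicalSpace X] : Prop :=
  Nonempty (SmoothManifoldStructure X)

/-- Submersions of manifolds. -/
def SmoothManifoldStructure.IsSubmersion {X : Type u} {Y : Type v} [DiffeologicalSpace X]
    [DiffeologicalSpace Y] (A : SmoothManifoldStructure X) (B : SmoothManifoldStructure Y)
    (f : X → Y) : Prop :=
  letI := A.topology
  letI := A.charted
  letI := B.topology
  letI := B.charted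
  Manifold.IsSubmersion (𝓡 A.dim) (𝓡 B.dim) ∞ f

/-- Quasi-étale diffeological spaces: there is a quasi-étale chart around every point. -/
def IsQUED (X : Type u) [DiffeologicalSpace X] : Prop :=
  ∀ x : X, ∃ (M : Type u) (_ : DiffeologicalSpace M), IsSmoothManifold M ∧
    ∃ π : M → X, IsQuasiEtale π ∧ x ∈ Set.range π

/-- The objects of the category of quasi-étale diffeological spaces. -/
structure QUED : Type (u + 1) where
  carrier : Type u
  [diffeology : DiffeologicalSpace carrier]
  isQUED : IsQUED carrier

attribute [instance] QUED.diffeology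

/-- The category of quasi-étale diffeological spaces and smooth maps. -/
instance QUED.category : CategoryTheory.Category.{u} QUED.{u} where
  Hom X Y := {f : X.carrier → Y.carrier // DSmooth f}
  id X := ⟨fun x => x, dSmooth_id'⟩
  comp f g := ⟨fun x => g.1 (f.1 x), g.2.comp f.2⟩

/-- A smooth map between quasi-étale diffeological spaces, as a morphism of the category. -/
def QUED.ofHom {X Y : Type u} [DiffeologicalSpace X] [DiffeologicalSpace Y] (hX : IsQUED X)
    (hY : IsQUED Y) (f : X → Y) (hf : DSmooth f) : QUED.mk X hX ⟶ QUED.mk Y hY :=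
  ⟨f, hf⟩

/-- A morphism `p : X ⟶ Z` is cartesian if for all `f : Y ⟶ Z` either the fibre product of `p` and
`f` exists or there is no commutative square over `p` and `f`. -/
def IsCartesianMorphism {C : Type u} [CategoryTheory.Category.{v} C] {X Z : C} (p : X ⟶ Z) : Prop :=
  ∀ ⦃Y : C⦄ (f : Y ⟶ Z), CategoryTheory.Limits.HasPullback p f ∨
    ¬ ∃ (W : C) (a : W ⟶ X) (b : W ⟶ Y),
      CategoryTheory.CategoryStruct.comp a p = CategoryTheory.CategoryStruct.comp b f

/-- `QUED`-submersions. -/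
def IsQUEDSubmersion {X Z : QUED.{u}} (p : X ⟶ Z) : Prop :=
  IsLocalSubduction p.1 ∧ IsCartesianMorphism p

/-! ### Groupoids -/

/-- A groupoid `G ⇉ X` with set of arrows `G` and set of objects `X`. The product `gh` is defined
when the source of `g` is the target of `h`. -/
structure GroupoidStructure (G : Type u) (X : Type v) where
  src : G → X
  tgt : G → X
  unit : X → G
  mul : {p : G × G // src p.1 = tgt p.2} → G
  inv : G → G
  src_unit : ∀ x, src (unit x) = x
  tgt_unit : ∀ x, tgt (unit x) = x
  src_mul : ∀ p, src (mul p) = src p.1.2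
  tgt_mul : ∀ p, tgt (mul p) = tgt p.1.1
  src_inv : ∀ g, src (inv g) = tgt g
  tgt_inv : ∀ g, tgt (inv g) = src g
  unit_mul : ∀ g, mul ⟨(unit (tgt g), g), src_unit _⟩ = g
  mul_unit : ∀ g, mul ⟨(g, unit (src g)), (tgt_unit _).symm⟩ = g
  mul_inv : ∀ g, mul ⟨(g, inv g), (tgt_inv g).symm⟩ = unit (tgt g)
  inv_mul : ∀ g, mul ⟨(inv g, g), src_inv g⟩ = unit (src g)
  mul_assoc : ∀ (g h k : G) (hgh : src g = tgt h) (hhk : src h = tgt k),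
    mul ⟨(g, mul ⟨(h, k), hhk⟩), hgh.trans (tgt_mul ⟨(h, k), hhk⟩).symm⟩ =
      mul ⟨(mul ⟨(g, h), hgh⟩, k), (src_mul ⟨(g, h), hgh⟩).trans hhk⟩

namespace GroupoidStructure

/-- The product of two composable arrows. -/
def comp {G : Type u} {X : Type v} (𝒢 : GroupoidStructure G X) (g h : G)
    (w : 𝒢.src g = 𝒢.tgt h) : G :=
  𝒢.mul ⟨(g, h), w⟩

section Smooth

/-- `QUED`-groupoids. The set of composable pairs carries the diffeology of the fibre product. -/
structure IsQUEDGroupoid {G X : Type u} [DiffeologicalSpace G] [DiffeologicalSpace X]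
    (𝒢 : GroupoidStructure G X) : Prop where
  arrows : IsQUED G
  objects : IsQUED X
  src_smooth : DSmooth 𝒢.src
  tgt_smooth : DSmooth 𝒢.tgt
  src_submersion : IsQUEDSubmersion (QUED.ofHom arrows objects 𝒢.src src_smooth)
  tgt_submersion : IsQUEDSubmersion (QUED.ofHom arrows objects 𝒢.tgt tgt_smooth)
  unit_smooth : DSmooth 𝒢.unit
  mul_smooth : DSmooth 𝒢.mul
  inv_smooth : DSmooth 𝒢.inv

/-- Singular Lie groupoids: `QUED`-groupoids whose space of objects is a smooth manifold. -/
def IsSingularLieGroupoid {G X : Type u} [DiffeologicalSpace G] [DiffeologicalSpace X]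
    (𝒢 : GroupoidStructure G X) : Prop :=
  𝒢.IsQUEDGroupoid ∧ IsSmoothManifold X

/-- Lie groupoids: arrows and objects are smooth manifolds, source and target are submersions and
all structure maps are smooth. -/
structure IsLieGroupoid {G : Type u} {X : Type v} [DiffeologicalSpace G] [DiffeologicalSpace X]
    (𝒢 : GroupoidStructure G X) : Prop where
  submersion : ∃ (A : SmoothManifoldStructure G) (B : SmoothManifoldStructure X),
    A.IsSubmersion B 𝒢.src ∧ A.IsSubmersion B 𝒢.tgt
  unit_smooth : DSmooth 𝒢.unit
  mul_smooth : DSmooth 𝒢.mul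
  inv_smooth : DSmooth 𝒢.inv

end Smooth

variable {G : Type u} {X : Type v} (𝒢 : GroupoidStructure G X)

theorem src_comp (g h : G) (w) : 𝒢.src (𝒢.comp g h w) = 𝒢.src h := 𝒢.src_mul _

theorem tgt_comp (g h : G) (w) : 𝒢.tgt (𝒢.comp g h w) = 𝒢.tgt g := 𝒢.tgt_mul _

theorem comp_congr {g g' h h' : G} (hg : g = g') (hh : h = h') (w) :
    𝒢.comp g h w = 𝒢.comp g' h' (hg ▸ hh ▸ w) := by
  subst hg hh; rfl

theorem comp_assoc (g h k : G) (w₁ w₂ w₃ w₄) :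
    𝒢.comp (𝒢.comp g h w₁) k w₂ = 𝒢.comp g (𝒢.comp h k w₃) w₄ :=
  (𝒢.mul_assoc g h k w₁ w₃).symm

theorem unit_comp {x : X} {g : G} (w) : 𝒢.comp (𝒢.unit x) g w = g := by
  have hx : x = 𝒢.tgt g := (𝒢.src_unit x).symm.trans w
  subst hx; exact 𝒢.unit_mul g

theorem comp_unit {x : X} {g : G} (w) : 𝒢.comp g (𝒢.unit x) w = g := by
  have hx : x = 𝒢.src g := (𝒢.tgt_unit x).symm.trans w.symm
  subst hx; exact 𝒢.mul_unit g

theorem comp_inv (g : G) (w) : 𝒢.comp g (𝒢.inv g) w = 𝒢.unit (𝒢.tgt g) := 𝒢.mul_inv g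

theorem inv_comp (g : G) (w) : 𝒢.comp (𝒢.inv g) g w = 𝒢.unit (𝒢.src g) := 𝒢.inv_mul g

theorem comp_inv_cancel (g h : G) (w₁ w₂) : 𝒢.comp g (𝒢.comp (𝒢.inv g) h w₁) w₂ = h := by
  rw [← 𝒢.comp_assoc g (𝒢.inv g) h (𝒢.tgt_inv g).symm
    (by rw [𝒢.src_comp]; exact w₁) w₁ w₂, 𝒢.comp_congr (𝒢.comp_inv g _) rfl, 𝒢.unit_comp]

theorem inv_comp_cancel (g h : G) (w₁ w₂) : 𝒢.comp (𝒢.inv g) (𝒢.comp g h w₁) w₂ = h := by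
  rw [← 𝒢.comp_assoc (𝒢.inv g) g h (𝒢.src_inv g)
    (by rw [𝒢.src_comp]; exact w₁) w₁ w₂, 𝒢.comp_congr (𝒢.inv_comp g _) rfl, 𝒢.unit_comp]

theorem comp_left_cancel {g h h' : G} (w w') (e : 𝒢.comp g h w = 𝒢.comp g h' w') : h = h' := by
  rw [← 𝒢.inv_comp_cancel g h w (by rw [𝒢.tgt_comp, 𝒢.src_inv]),
    ← 𝒢.inv_comp_cancel g h' w' (by rw [𝒢.tgt_comp, 𝒢.src_inv])]
  exact 𝒢.comp_congr rfl e _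

theorem inv_inv (g : G) : 𝒢.inv (𝒢.inv g) = g := by
  refine 𝒢.comp_left_cancel (g := 𝒢.inv g) (𝒢.tgt_inv _).symm (𝒢.src_inv _) ?_
  rw [𝒢.comp_inv, 𝒢.inv_comp, 𝒢.tgt_inv]

/-- The conjugate `g n g⁻¹` of an isotropy arrow `n` at the source of `g`. -/
def conj (g n : G) (hs : 𝒢.src n = 𝒢.src g) (ht : 𝒢.tgt n = 𝒢.src g) : G :=
  𝒢.comp (𝒢.comp g n ht.symm) (𝒢.inv g) (by rw [𝒢.src_comp, 𝒢.tgt_inv, hs])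

/-- Wide normal subgroupoids. -/
structure WideNormalSubgroupoid where
  carrier : Set G
  unit_mem : ∀ x, 𝒢.unit x ∈ carrier
  comp_mem : ∀ {g h : G} (w : 𝒢.src g = 𝒢.tgt h), g ∈ carrier → h ∈ carrier →
    𝒢.comp g h w ∈ carrier
  inv_mem : ∀ {g : G}, g ∈ carrier → 𝒢.inv g ∈ carrier
  conj_mem : ∀ (g : G) {n : G} (hs : 𝒢.src n = 𝒢.src g) (ht : 𝒢.tgt n = 𝒢.src g),
    n ∈ carrier → 𝒢.conj g n hs ht ∈ carrier

namespace WideNormalSubgroupoid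

variable {𝒢}
variable (N : 𝒢.WideNormalSubgroupoid)

/-- The subgroupoid consists of isotropy arrows. -/
def IsIsotropic : Prop := ∀ n ∈ N.carrier, 𝒢.src n = 𝒢.tgt n

/-- Two arrows `g`, `h` are equivalent if `h = g n` for some `n` in the subgroupoid. -/
def setoid : Setoid G where
  r g h := ∃ n ∈ N.carrier, ∃ w : 𝒢.src g = 𝒢.tgt n, 𝒢.comp g n w = h
  iseqv := by
    refine ⟨fun g => ⟨_, N.unit_mem (𝒢.src g), (𝒢.tgt_unit _).symm, 𝒢.comp_unit _⟩, ?_, ?_⟩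
    · rintro g _ ⟨n, hn, w, rfl⟩
      refine ⟨𝒢.inv n, N.inv_mem hn, by rw [𝒢.src_comp, 𝒢.tgt_inv], ?_⟩
      rw [𝒢.comp_assoc g n (𝒢.inv n) w _ (𝒢.tgt_inv n).symm (by rw [𝒢.tgt_comp]; exact w),
        𝒢.comp_congr rfl (𝒢.comp_inv n _), 𝒢.comp_unit]
    · rintro g _ _ ⟨n, hn, w, rfl⟩ ⟨m, hm, w', rfl⟩
      have w₁ : 𝒢.src n = 𝒢.tgt m := by rwa [𝒢.src_comp] at w'
      exact ⟨𝒢.comp n m w₁, N.comp_mem _ hn hm, by rw [𝒢.tgt_comp]; exact w,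
        (𝒢.comp_assoc g n m w w' w₁ _).symm⟩

/-- The set `G/N` of cosets. It carries the quotient diffeology. -/
abbrev Quot : Type u := Quotient N.setoid

variable {N}

theorem rel_src (hN : N.IsIsotropic) {g h : G} (e : N.setoid g h) : 𝒢.src g = 𝒢.src h := by
  obtain ⟨n, hn, w, rfl⟩ := e
  rw [𝒢.src_comp, w, hN n hn]

theorem rel_tgt {g h : G} (e : N.setoid g h) : 𝒢.tgt g = 𝒢.tgt h := by
  obtain ⟨n, hn, w, rfl⟩ := e
  rw [𝒢.tgt_comp]

theorem rel_comp (hN : N.IsIsotropic) {g g' h h' : G} (eg : N.setoid g g') (eh : N.setoid h h')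
    (w : 𝒢.src g = 𝒢.tgt h) (w' : 𝒢.src g' = 𝒢.tgt h') :
    N.setoid (𝒢.comp g h w) (𝒢.comp g' h' w') := by
  obtain ⟨n, hn, wn, rfl⟩ := eg
  obtain ⟨m, hm, wm, rfl⟩ := eh
  have hs : 𝒢.src n = 𝒢.src (𝒢.inv h) := by rw [𝒢.src_inv, ← w, wn, hN n hn]
  have ht : 𝒢.tgt n = 𝒢.src (𝒢.inv h) := by rw [𝒢.src_inv, ← w, wn]
  have w₁ : 𝒢.src (𝒢.conj (𝒢.inv h) n hs ht) = 𝒢.tgt m := by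
    rw [conj, 𝒢.src_comp, 𝒢.inv_inv, wm]
  have w₂ : 𝒢.src h = 𝒢.tgt (𝒢.conj (𝒢.inv h) n hs ht) := by
    rw [conj, 𝒢.tgt_comp, 𝒢.tgt_comp, 𝒢.tgt_inv]
  have wnh : 𝒢.src n = 𝒢.tgt h := by rw [hs, 𝒢.src_inv]
  have key : 𝒢.comp h (𝒢.conj (𝒢.inv h) n hs ht) w₂ = 𝒢.comp n h wnh := by
    have h1 : 𝒢.conj (𝒢.inv h) n hs ht =
        𝒢.comp (𝒢.inv h) (𝒢.comp n h wnh) (by rw [𝒢.tgt_comp]; exact ht.symm) := by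
      rw [conj, 𝒢.comp_congr rfl (𝒢.inv_inv h)]
      exact 𝒢.comp_assoc _ _ _ _ _ _ _
    rw [𝒢.comp_congr rfl h1]
    exact 𝒢.comp_inv_cancel _ _ _ _
  refine ⟨𝒢.comp (𝒢.conj (𝒢.inv h) n hs ht) m w₁, N.comp_mem _ (N.conj_mem _ hs ht hn) hm,
    by rw [𝒢.src_comp, 𝒢.tgt_comp]; exact w₂, ?_⟩
  rw [𝒢.comp_assoc g h _ w _ (by rw [𝒢.tgt_comp]; exact w₂)
      (by rw [𝒢.tgt_comp]; exact w),
    𝒢.comp_assoc g n _ wn w' (by rw [𝒢.tgt_comp]; exact wnh)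
      (by rw [𝒢.tgt_comp]; exact wn)]
  refine 𝒢.comp_congr rfl ?_ _
  rw [← 𝒢.comp_assoc h _ m w₂ (by rw [𝒢.src_comp]; exact w₁) w₁,
    ← 𝒢.comp_assoc n h m wnh (by rw [𝒢.src_comp]; exact wm) wm]
  exact 𝒢.comp_congr key rfl _

theorem rel_inv (hN : N.IsIsotropic) {g g' : G} (e : N.setoid g g') :
    N.setoid (𝒢.inv g) (𝒢.inv g') := by
  obtain ⟨n, hn, w, rfl⟩ := e
  have hn' := N.inv_mem hn
  have ht : 𝒢.tgt (𝒢.inv n) = 𝒢.src g := by rw [𝒢.tgt_inv, hN n hn, w]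
  have hs : 𝒢.src (𝒢.inv n) = 𝒢.src g := by rw [𝒢.src_inv, w]
  refine ⟨𝒢.conj g (𝒢.inv n) hs ht, N.conj_mem g hs ht hn', by
    rw [conj, 𝒢.tgt_comp, 𝒢.tgt_comp, 𝒢.src_inv], ?_⟩
  refine 𝒢.comp_left_cancel (g := 𝒢.comp g n w) ?_ (𝒢.tgt_inv _).symm ?_
  · rw [𝒢.src_comp, 𝒢.tgt_comp, 𝒢.tgt_inv, hN n hn, w]
  have wi : 𝒢.src (𝒢.inv n) = 𝒢.tgt (𝒢.inv g) := by rw [hs, 𝒢.tgt_inv]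
  have wg : 𝒢.src g = 𝒢.tgt (𝒢.comp (𝒢.inv n) (𝒢.inv g) wi) := by rw [𝒢.tgt_comp]; exact ht.symm
  have wn : 𝒢.src n = 𝒢.tgt (𝒢.comp (𝒢.inv n) (𝒢.inv g) wi) := by rw [𝒢.tgt_comp, 𝒢.tgt_inv]
  have h2 : 𝒢.conj g (𝒢.inv n) hs ht = 𝒢.comp g (𝒢.comp (𝒢.inv n) (𝒢.inv g) wi) wg :=
    𝒢.comp_assoc _ _ _ _ _ _ _
  have h1 : ∀ w₀, 𝒢.comp (𝒢.inv g) (𝒢.conj g (𝒢.inv n) hs ht) w₀ =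
      𝒢.comp (𝒢.inv n) (𝒢.inv g) wi := fun w₀ =>
    (𝒢.comp_congr rfl h2 w₀).trans (𝒢.inv_comp_cancel _ _ _ _)
  have wgn : 𝒢.src (𝒢.comp g n w) = 𝒢.tgt (𝒢.comp (𝒢.inv n) (𝒢.inv g) wi) := by
    rw [𝒢.src_comp]; exact wn
  have h3 : 𝒢.comp (𝒢.comp g n w) (𝒢.comp (𝒢.inv n) (𝒢.inv g) wi) wgn =
      𝒢.unit (𝒢.tgt (𝒢.comp g n w)) := by
    rw [𝒢.comp_assoc g n (𝒢.comp (𝒢.inv n) (𝒢.inv g) wi) w wgn wn (by rw [𝒢.tgt_comp]; exact w),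
      𝒢.comp_congr rfl (𝒢.comp_inv_cancel n (𝒢.inv g) wi wn), 𝒢.comp_inv, 𝒢.tgt_comp]
  exact ((𝒢.comp_congr rfl (h1 _) _).trans h3).trans (𝒢.comp_inv _ _).symm

/-- The source map of `G/N`. -/
def quotSrc (hN : N.IsIsotropic) : N.Quot → X :=
  Quotient.lift 𝒢.src fun _ _ e => rel_src hN e

variable (N) in
/-- The target map of `G/N`. -/
def quotTgt : N.Quot → X :=
  Quotient.lift 𝒢.tgt fun _ _ e => rel_tgt e

theorem src_out (hN : N.IsIsotropic) (a : N.Quot) : 𝒢.src a.out = quotSrc hN a := by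
  conv_rhs => rw [← a.out_eq]
  rfl

theorem tgt_out (a : N.Quot) : 𝒢.tgt a.out = N.quotTgt a := by
  conv_rhs => rw [← a.out_eq]
  rfl

/-- The product of cosets; see `quotMul_mk`. -/
def quotMul (hN : N.IsIsotropic) (p : {p : N.Quot × N.Quot // quotSrc hN p.1 = N.quotTgt p.2}) :
    N.Quot :=
  Quotient.mk N.setoid (𝒢.comp p.1.1.out p.1.2.out
    ((src_out hN p.1.1).trans (p.2.trans (tgt_out p.1.2).symm)))

/-- The product of the cosets of `g` and `h` is the coset of `gh`. -/
theorem quotMul_mk (hN : N.IsIsotropic) (g h : G) (w : 𝒢.src g = 𝒢.tgt h) :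
    quotMul hN ⟨(Quotient.mk N.setoid g, Quotient.mk N.setoid h), w⟩ =
      Quotient.mk N.setoid (𝒢.comp g h w) :=
  Quotient.sound (rel_comp hN (Quotient.mk_out (s := N.setoid) g)
    (Quotient.mk_out (s := N.setoid) h) _ _)

/-- The inverse of the coset of `g` is the coset of `g⁻¹`. -/
def quotInv (hN : N.IsIsotropic) : N.Quot → N.Quot :=
  Quotient.map 𝒢.inv fun _ _ e => rel_inv hN e

variable (N) in
/-- The quotient groupoid `G/N ⇉ X`, with the structure induced from `G ⇉ X`. -/
def quotientGroupoid (hN : N.IsIsotropic) : GroupoidStructure N.Quot X where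
  src := quotSrc hN
  tgt := N.quotTgt
  unit x := Quotient.mk N.setoid (𝒢.unit x)
  mul := quotMul hN
  inv := quotInv hN
  src_unit := 𝒢.src_unit
  tgt_unit := 𝒢.tgt_unit
  src_mul := by
    rintro ⟨⟨a, b⟩, w⟩
    induction a using Quotient.ind
    induction b using Quotient.ind
    exact (congrArg (quotSrc hN) (quotMul_mk hN _ _ w)).trans (𝒢.src_comp _ _ w)
  tgt_mul := by
    rintro ⟨⟨a, b⟩, w⟩
    induction a using Quotient.ind
    induction b using Quotient.ind
    exact (congrArg N.quotTgt (quotMul_mk hN _ _ w)).trans (𝒢.tgt_comp _ _ w)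
  src_inv a := by
    induction a using Quotient.ind
    exact 𝒢.src_inv _
  tgt_inv a := by
    induction a using Quotient.ind
    exact 𝒢.tgt_inv _
  unit_mul a := by
    induction a using Quotient.ind
    exact (quotMul_mk hN _ _ (𝒢.src_unit _)).trans (congrArg _ (𝒢.unit_comp _))
  mul_unit a := by
    induction a using Quotient.ind
    exact (quotMul_mk hN _ _ (𝒢.tgt_unit _).symm).trans (congrArg _ (𝒢.comp_unit _))
  mul_inv a := by
    induction a using Quotient.ind
    exact (quotMul_mk hN _ _ (𝒢.tgt_inv _).symm).trans (congrArg _ (𝒢.comp_inv _ _))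
  inv_mul a := by
    induction a using Quotient.ind
    exact (quotMul_mk hN _ _ (𝒢.src_inv _)).trans (congrArg _ (𝒢.inv_comp _ _))
  mul_assoc a b c hab hbc := by
    induction a using Quotient.ind with | _ g
    induction b using Quotient.ind with | _ h
    induction c using Quotient.ind with | _ k
    have hab' : 𝒢.src g = 𝒢.tgt h := hab
    have hbc' : 𝒢.src h = 𝒢.tgt k := hbc
    have h1 := quotMul_mk hN h k hbc'
    have h2 := quotMul_mk hN g h hab'
    have e1 := quotMul_mk hN g (𝒢.comp h k hbc') (by rw [𝒢.tgt_comp]; exact hab')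
    have e2 := quotMul_mk hN (𝒢.comp g h hab') k (by rw [𝒢.src_comp]; exact hbc')
    rw [← 𝒢.comp_assoc g h k hab' (by rw [𝒢.src_comp]; exact hbc') hbc', ← e2] at e1
    simp only [h1, h2]
    exact e1

end WideNormalSubgroupoid

end GroupoidStructure

end

/-!
Write `π : G → G/N` for the projection. The first point is that `π` is a local subduction: a local
lift of a plot of `G/N` passes through any prescribed point of the coset after multiplication with
a plot of `N`, which exists because the source map of `N` is a local subduction
(`isLocalSubduction_mk`). The second point is that two plots of `G` with the same image in `G/N`,
lying over a single point of `M`, differ by right translation with one fixed arrow, because their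
quotient is a plot of a totally disconnected fibre of `N` (`exists_right_translation`).

The main step is that for every smooth map `f : Y → M` from a quasi-étale space, the diffeological
fibre product of the source map of `G/N` with `f` is quasi-étale
(`isQUED_fibreProduct_quotSrc`). It is then a fibre product in the category, so that the source map
is a `QUED`-submersion; the case `Y = M` shows that `G/N` is quasi-étale, and inversion takes care
of the target map.

Quasi-étale charts of the fibre product need not be defined on the whole manifold `G ×_M V`, for
`V → Y` a quasi-étale chart: it suffices to cover the fibre product locally, by charts with domain
a Euclidean space. Quasi-étale maps from Euclidean spaces are handled through `IsQEParam`, where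
rigidity is the injectivity of the derivative of self-maps, which by the inverse function theorem is
equivalent to being a local diffeomorphism (`IsQEParam.isQuasiEtale`,
`IsQuasiEtale.isQEParam_comp`). In a chart of `G` in which the source map is a projection, a
self-map over the fibre product has block triangular derivative. One diagonal block belongs to the
right translation by a fixed arrow along a source fibre, and is invertible; the other one belongs to
a self-map over the chart of `Y`, and is injective by rigidity of that chart
(`isQEParam_fibreProduct`).
-/

/-! ### Plots -/

theorem exists_smooth_retract_nhds {n : ℕ} {U : Set (EuclideanSpace ℝ (Fin n))}
    {x : EuclideanSpace ℝ (Fin n)} (hU : U ∈ 𝓝 x) :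
    ∃ ρ : EuclideanSpace ℝ (Fin n) → EuclideanSpace ℝ (Fin n), ContDiff ℝ ∞ ρ ∧ (∀ y, ρ y ∈ U) ∧
      ρ x = x ∧ ∀ᶠ y in 𝓝 x, ρ y = y := by
  obtain ⟨W, hWU, hW, hxW⟩ := mem_nhds_iff.1 hU
  obtain ⟨ρ, hρ, hρW, V, hV, hxV, h⟩ := exists_smooth_retract hW hxW
  exact ⟨ρ, hρ, fun y => hWU (hρW y), h x hxV, Filter.mem_of_superset (hV.mem_nhds hxV) h⟩

section Plots

variable {X : Type u} {Y : Type v} [DiffeologicalSpace X] [DiffeologicalSpace Y]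

theorem isPlot_of_locally {n : ℕ} {p : EuclideanSpace ℝ (Fin n) → X}
    (h : ∀ z, ∃ q : EuclideanSpace ℝ (Fin n) → X, IsPlot q ∧ ∀ᶠ y in 𝓝 z, p y = q y) :
    IsPlot p := by
  refine DiffeologicalSpace.locality fun z => ?_
  obtain ⟨q, hq, hpq⟩ := h z
  obtain ⟨U, hU, hUo, hz⟩ := mem_nhds_iff.1 hpq
  refine ⟨U, hUo, hz, fun {m f} hf hs => ?_⟩
  have : p ∘ f = q ∘ f := funext fun y => hU (hf y)
  rw [this]
  exact isPlot_reparam hq hs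

theorem IsLocalSubduction.exists_lift {f : X → Y} (hf : IsLocalSubduction f) {n : ℕ}
    {φ : EuclideanSpace ℝ (Fin n) → Y} (hφ : IsPlot φ) {x : X} {z : EuclideanSpace ℝ (Fin n)}
    (h : φ z = f x) : ∃ ψ : EuclideanSpace ℝ (Fin n) → X, IsPlot ψ ∧ ψ z = x ∧
      ∀ᶠ y in 𝓝 z, φ y = f (ψ y) := by
  obtain ⟨V, hV, hz, ψ, hψ, hψz, H⟩ := hf.2 n φ hφ x z h
  exact ⟨ψ, hψ, hψz, Filter.mem_of_superset (hV.mem_nhds hz) H⟩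

theorem isLocalSubduction_of_exists_lift {f : X → Y} (hf : DSmooth f)
    (h : ∀ (n : ℕ) (φ : EuclideanSpace ℝ (Fin n) → Y), IsPlot φ →
      ∀ (x : X) (z : EuclideanSpace ℝ (Fin n)), φ z = f x →
        ∃ ψ : EuclideanSpace ℝ (Fin n) → X, IsPlot ψ ∧ ψ z = x ∧ ∀ᶠ y in 𝓝 z, φ y = f (ψ y)) :
    IsLocalSubduction f := by
  refine ⟨hf, fun n φ hφ x z e => ?_⟩
  obtain ⟨ψ, hψ, hψz, H⟩ := h n φ hφ x z e
  obtain ⟨V, hV, hVo, hz⟩ := mem_nhds_iff.1 H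
  exact ⟨V, hVo, hz, ψ, hψ, hψz, fun y hy => hV hy⟩

theorem IsPlot.preimage_mem_nhds {n : ℕ} {p : EuclideanSpace ℝ (Fin n) → X} (hp : IsPlot p)
    {U : Set X} (hU : IsOpen[dTopology] U) {z : EuclideanSpace ℝ (Fin n)} (hz : p z ∈ U) :
    ∀ᶠ y in 𝓝 z, p y ∈ U :=
  (isOpen_iff_preimages_plots.1 hU n p hp).mem_nhds hz

theorem dSmooth_quotient_mk (r : Setoid X) : DSmooth (Quotient.mk r) := fun _ p hp _ =>
  ⟨Set.univ, isOpen_univ, trivial, p, hp, fun _ _ => rfl⟩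

end Plots

/-! ### Injective derivatives -/

/-- If `g ∘ f` is the identity near `a`, then the derivative of `f` at `a` is injective. -/
theorem fderiv_injective_of_eventually_leftInverse {E : Type v} {E' : Type w}
    [NormedAddCommGroup E] [NormedSpace ℝ E] [NormedAddCommGroup E'] [NormedSpace ℝ E']
    {f : E → E'} {g : E' → E} {a : E}
    (hf : DifferentiableAt ℝ f a) (hg : DifferentiableAt ℝ g (f a))
    (h : ∀ᶠ y in 𝓝 a, g (f y) = y) : Function.Injective (fderiv ℝ f a) := by
  have h1 : fderiv ℝ (g ∘ f) a = (fderiv ℝ g (f a)).comp (fderiv ℝ f a) := fderiv_comp a hg hf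
  have h2 : fderiv ℝ (g ∘ f) a = ContinuousLinearMap.id ℝ E :=
    (Filter.EventuallyEq.fderiv_eq h).trans fderiv_id
  intro v w hvw
  have h3 := congrArg (fun T => T v) (h1.symm.trans h2)
  have h4 := congrArg (fun T => T w) (h1.symm.trans h2)
  simp only [ContinuousLinearMap.comp_apply, ContinuousLinearMap.id_apply] at h3 h4
  rw [← h3, ← h4, hvw]

/-- A map of products whose derivative is block triangular with injective diagonal blocks has
injective derivative. -/
theorem fderiv_injective_of_triangular {E₁ : Type v} {E₂ : Type w} [NormedAddCommGroup E₁]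
    [NormedSpace ℝ E₁] [NormedAddCommGroup E₂] [NormedSpace ℝ E₂] {F : E₁ × E₂ → E₁ × E₂}
    {b : E₁} {v : E₂} (hF : DifferentiableAt ℝ F (b, v))
    (h₁ : Function.Injective (fderiv ℝ (fun b' => (F (b', v)).1) b))
    (h₂ : Function.Injective (fderiv ℝ (fun v' => (F (b, v')).2) v))
    (h₂₁ : ∀ᶠ b' in 𝓝 b, (F (b', v)).2 = (F (b, v)).2) :
    Function.Injective (fderiv ℝ F (b, v)) := by
  have hl := HasFDerivAt.comp (g := F) (f := fun b' => (b', v)) b hF.hasFDerivAt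
    (hasFDerivAt_prodMk_left b v)
  have hr := HasFDerivAt.comp (g := F) (f := fun v' => (b, v')) v hF.hasFDerivAt
    (hasFDerivAt_prodMk_right b v)
  have e₁ : ∀ β, fderiv ℝ (fun b' => (F (b', v)).1) b β = (fderiv ℝ F (b, v) (β, 0)).1 :=
    fun β => congrArg (fun T => T β) hl.fst.fderiv
  have e₂ : ∀ η, fderiv ℝ (fun v' => (F (b, v')).2) v η = (fderiv ℝ F (b, v) (0, η)).2 :=
    fun η => congrArg (fun T => T η) hr.snd.fderiv
  have e₂₁ : ∀ β, (fderiv ℝ F (b, v) (β, 0)).2 = 0 := fun β => by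
    have h3 : fderiv ℝ (fun b' => (F (b', v)).2) b = 0 :=
      (Filter.EventuallyEq.fderiv_eq h₂₁).trans (by simp)
    exact congrArg (fun T => T β) (hl.snd.fderiv.symm.trans h3)
  refine (injective_iff_map_eq_zero _).2 ?_
  rintro ⟨β, η⟩ h
  have hsum : fderiv ℝ F (b, v) (β, η) = fderiv ℝ F (b, v) (β, 0) + fderiv ℝ F (b, v) (0, η) := by
    rw [← map_add]
    simp
  have hη : η = 0 := by
    refine (injective_iff_map_eq_zero _).1 h₂ η ?_
    rw [e₂]
    have := congrArg Prod.snd (hsum.symm.trans h)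
    rwa [Prod.snd_add, e₂₁, zero_add] at this
  subst hη
  have hβ : β = 0 := by
    refine (injective_iff_map_eq_zero _).1 h₁ β ?_
    rw [e₁, h]
    rfl
  rw [hβ]
  rfl

/-! ### Parametrizations by normed spaces -/

section Parametrizations

variable {X : Type u} [DiffeologicalSpace X]
  {E : Type v} [NormedAddCommGroup E] [NormedSpace ℝ E]
  {E' : Type w} [NormedAddCommGroup E'] [NormedSpace ℝ E']

/-- Smooth maps from a normed space to a diffeological space. No diffeology on the normed space is
mentioned: for products of Euclidean spaces there would be two of them, which agree only
propositionally. -/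
def IsSmoothParam (c : E → X) : Prop :=
  ∀ ⦃n : ℕ⦄ ⦃ψ : EuclideanSpace ℝ (Fin n) → E⦄, ContDiff ℝ ∞ ψ → IsPlot (fun y => c (ψ y))

/-- Diffeomorphisms from a normed space onto a D-open subset, i.e. inverses of charts. -/
structure IsOpenParam (κ : E → X) : Prop where
  smooth : IsSmoothParam κ
  injective : Function.Injective κ
  isOpen_range : IsOpen[dTopology] (Set.range κ)
  lift : ∀ ⦃n : ℕ⦄ ⦃p : EuclideanSpace ℝ (Fin n) → X⦄, IsPlot p → (∀ y, p y ∈ Set.range κ) →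
    ∃ ψ : EuclideanSpace ℝ (Fin n) → E, ContDiff ℝ ∞ ψ ∧ ∀ y, p y = κ (ψ y)

/-- Quasi-étale maps whose domain is a normed space. The rigidity condition is infinitesimal: a
smooth self-map over `X` has injective derivative. In finite dimension this amounts to its being a
local diffeomorphism, by the inverse function theorem. -/
structure IsQEParam (c : E → X) : Prop where
  smooth : IsSmoothParam c
  lift : ∀ ⦃n : ℕ⦄ ⦃p : EuclideanSpace ℝ (Fin n) → X⦄, IsPlot p →
    ∀ ⦃z : EuclideanSpace ℝ (Fin n)⦄ ⦃e : E⦄, p z = c e →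
      ∃ ψ : EuclideanSpace ℝ (Fin n) → E, ContDiff ℝ ∞ ψ ∧ ψ z = e ∧ ∀ᶠ y in 𝓝 z, p y = c (ψ y)
  disc : ∀ ⦃n : ℕ⦄ ⦃γ : EuclideanSpace ℝ (Fin n) → E⦄, ContDiff ℝ ∞ γ →
    (∀ y y', c (γ y) = c (γ y')) → ∀ y y', γ y = γ y'
  rigid : ∀ ⦃F : E → E⦄, ContDiff ℝ ∞ F → ∀ ⦃e : E⦄, (∀ᶠ y in 𝓝 e, c (F y) = c y) →
    Function.Injective (fderiv ℝ F e)

/-- A chart inverse lifts plots locally, through the given point. -/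
theorem IsOpenParam.exists_lift {κ : E → X} (hκ : IsOpenParam κ) {n : ℕ}
    {p : EuclideanSpace ℝ (Fin n) → X} (hp : IsPlot p) {z : EuclideanSpace ℝ (Fin n)} {e : E}
    (h : p z = κ e) : ∃ ψ : EuclideanSpace ℝ (Fin n) → E, ContDiff ℝ ∞ ψ ∧ ψ z = e ∧
      ∀ᶠ y in 𝓝 z, p y = κ (ψ y) := by
  obtain ⟨ρ, hρ, hρU, hρz, hρe⟩ := exists_smooth_retract_nhds
    (IsPlot.preimage_mem_nhds hp hκ.isOpen_range (z := z) ⟨e, h.symm⟩)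
  obtain ⟨ψ, hψ, H⟩ := hκ.lift (isPlot_reparam hp hρ) hρU
  refine ⟨ψ, hψ, hκ.injective ?_, hρe.mono fun y hy => ?_⟩
  · rw [← H z, Function.comp_apply, hρz, h]
  · rw [← H y, Function.comp_apply, hy]

theorem IsOpenParam.isQEParam {κ : E → X} (hκ : IsOpenParam κ) : IsQEParam κ where
  smooth := hκ.smooth
  lift _ _ hp _ _ h := hκ.exists_lift hp h
  disc _ _ _ h y y' := hκ.injective (h y y')
  rigid F hF e h :=
    fderiv_injective_of_eventually_leftInverse (hF.differentiable (by simp) e)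
      (differentiableAt_id (𝕜 := ℝ)) (h.mono fun _ hy => hκ.injective hy)

theorem IsQEParam.comp_continuousLinearEquiv {c : E → X} (hc : IsQEParam c) (L : E' ≃L[ℝ] E) :
    IsQEParam fun e => c (L e) where
  smooth _ _ hψ := hc.smooth (L.contDiff.comp hψ)
  lift n p hp z e h := by
    obtain ⟨ψ, hψ, hz, H⟩ := hc.lift hp h
    exact ⟨fun y => L.symm (ψ y), L.symm.contDiff.comp hψ, by simp [hz], by simpa using H⟩
  disc n γ hγ h y y' := L.injective (hc.disc (L.contDiff.comp hγ) h y y')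
  rigid F hF e h := by
    have hG : ContDiff ℝ ∞ (fun x => L (F (L.symm x))) :=
      L.contDiff.comp (hF.comp L.symm.contDiff)
    have hcont : Filter.Tendsto L.symm (𝓝 (L e)) (𝓝 e) := by
      simpa using L.symm.continuous.tendsto (L e)
    have key := hc.rigid hG (e := L e) (by simpa using hcont.eventually h)
    have h1 : fderiv ℝ (fun x => L (F (L.symm x))) (L e) =
        (L : E' →L[ℝ] E).comp ((fderiv ℝ F e).comp (L.symm : E →L[ℝ] E')) := by
      have hFd : HasFDerivAt F (fderiv ℝ F e) (L.symm (L e)) := by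
        simpa using (hF.differentiable (by simp) e).hasFDerivAt
      exact (L.hasFDerivAt.comp (L e) (hFd.comp (L e) L.symm.hasFDerivAt)).fderiv
    intro v w hvw
    rw [h1] at key
    refine L.injective (key ?_)
    simp [hvw]

/-- Quasi-étale parametrizations are transported by diffeomorphisms of the target. -/
theorem IsQEParam.comp_diffeo {Y : Type*} [DiffeologicalSpace Y] {c : E → X} (hc : IsQEParam c)
    (e : X ≃ Y) (he : DSmooth e) (he' : DSmooth e.symm) : IsQEParam fun y => e (c y) where
  smooth _ _ hψ := he _ _ (hc.smooth hψ)
  lift n p hp z a h := by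
    obtain ⟨ψ, hψ, hz, H⟩ := hc.lift (he' _ _ hp) (e := a) (z := z) (by simp [h])
    exact ⟨ψ, hψ, hz, H.mono fun y hy => by simp [← hy]⟩
  disc n γ hγ h := hc.disc hγ fun y y' => e.injective (h y y')
  rigid F hF a h := hc.rigid hF (h.mono fun _ hy => e.injective hy)

end Parametrizations

/-! ### Charts of manifolds and submersions -/

section Charts

variable {X : Type u} [DiffeologicalSpace X] {E : Type v} [NormedAddCommGroup E] [NormedSpace ℝ E]

/-- A chart `φ` of the maximal atlas, composed with a diffeomorphism `σ` of a normed space onto an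
open subset `T` of the chart's target. -/
theorem SmoothManifoldStructure.isOpenParam (A : SmoothManifoldStructure X) :
    letI := A.topology
    letI := A.charted
    ∀ {φ : OpenPartialHomeomorph X (EuclideanSpace ℝ (Fin A.dim))},
      φ ∈ IsManifold.maximalAtlas (𝓡 A.dim) ∞ X →
      ∀ {σ : E → EuclideanSpace ℝ (Fin A.dim)} {τ : EuclideanSpace ℝ (Fin A.dim) → E}
        {T : Set (EuclideanSpace ℝ (Fin A.dim))}, ContDiff ℝ ∞ σ → IsOpen T → T ⊆ φ.target →
        (∀ e, σ e ∈ T) → ContDiffOn ℝ ∞ τ T → (∀ y ∈ T, σ (τ y) = y) → (∀ e, τ (σ e) = e) →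
        IsOpenParam fun e => φ.symm (σ e) := by
  let := A.topology
  let := A.charted
  let := A.isManifold
  intro φ hφ σ τ T hσ hT hTφ hσT hτ hστ hτσ
  have hrange : Set.range (fun e => φ.symm (σ e)) = φ.source ∩ φ ⁻¹' T := by
    ext x
    constructor
    · rintro ⟨e, rfl⟩
      exact ⟨φ.map_target (hTφ (hσT e)), by simpa [φ.right_inv (hTφ (hσT e))] using hσT e⟩
    · rintro ⟨hx, hxT⟩
      exact ⟨τ (φ x), by simp only [hστ _ hxT, φ.left_inv hx]⟩
  refine ⟨?_, ?_, ?_, ?_⟩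
  · intro n ψ hψ
    rw [A.isPlot_iff]
    have h1 : ContMDiff (𝓡 n) (𝓡 A.dim) ∞ (fun y => σ (ψ y)) := (hσ.comp hψ).contMDiff
    exact (contMDiffOn_symm_of_mem_maximalAtlas hφ).comp_contMDiff h1 fun y => hTφ (hσT _)
  · intro e e' h
    rw [← hτσ e, ← hτσ e', φ.symm.injOn (hTφ (hσT e)) (hTφ (hσT e')) h]
  · rw [hrange, isOpen_iff_preimages_plots]
    exact fun n p hp =>
      (φ.isOpen_inter_preimage hT).preimage ((A.isPlot_iff p).1 hp).continuous
  · intro n p hp hpr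
    rw [A.isPlot_iff] at hp
    rw [hrange] at hpr
    have h1 : ContDiff ℝ ∞ (fun y => φ (p y)) :=
      ((contMDiffOn_of_mem_maximalAtlas hφ).comp_contMDiff hp fun y => (hpr y).1).contDiff
    refine ⟨fun y => τ (φ (p y)), hτ.comp_contDiff h1 fun y => (hpr y).2, fun y => ?_⟩
    rw [hστ _ (hpr y).2, φ.left_inv (hpr y).1]

/-- Every D-neighbourhood of a point of a manifold contains a chart domain that is diffeomorphic to
Euclidean space. -/
theorem SmoothManifoldStructure.exists_isOpenParam (A : SmoothManifoldStructure X) {W : Set X}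
    (hW : IsOpen[dTopology] W) {x : X} (hx : x ∈ W) :
    ∃ κ : EuclideanSpace ℝ (Fin A.dim) → X, IsOpenParam κ ∧ κ 0 = x ∧ ∀ e, κ e ∈ W := by
  let := A.topology
  let := A.charted
  let := A.isManifold
  set φ := chartAt (EuclideanSpace ℝ (Fin A.dim)) x with hφdef
  have hφ : φ ∈ IsManifold.maximalAtlas (𝓡 A.dim) ∞ X := IsManifold.chart_mem_maximalAtlas x
  have hxs : x ∈ φ.source := mem_chart_source _ x
  obtain ⟨ρ, hρ, hρU, hρx, hρe⟩ := exists_smooth_retract_nhds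
    (φ.open_target.mem_nhds (φ.map_source hxs))
  have hp : IsPlot fun y => φ.symm (ρ y) := by
    rw [A.isPlot_iff]
    exact (contMDiffOn_symm_of_mem_maximalAtlas hφ).comp_contMDiff hρ.contMDiff hρU
  have hW' := IsPlot.preimage_mem_nhds hp hW (z := φ x)
    (by simpa only [hρx, φ.left_inv hxs] using hx)
  obtain ⟨r, hr, hball⟩ := Metric.mem_nhds_iff.1
    (Filter.inter_mem (Filter.inter_mem hW' hρe) (φ.open_target.mem_nhds (φ.map_source hxs)))
  refine ⟨_, A.isOpenParam hφ (T := Metric.ball (φ x) r)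
    (σ := OpenPartialHomeomorph.univBall (φ x) r)
    (τ := (OpenPartialHomeomorph.univBall (φ x) r).symm)
    OpenPartialHomeomorph.contDiff_univBall Metric.isOpen_ball (fun y hy => (hball hy).2) ?_
    OpenPartialHomeomorph.contDiffOn_univBall_symm ?_ ?_, ?_, ?_⟩
  · intro e
    rw [← OpenPartialHomeomorph.univBall_target (φ x) hr]
    exact OpenPartialHomeomorph.map_source _ (by simp)
  · intro y hy
    exact OpenPartialHomeomorph.right_inv _
      (by rwa [OpenPartialHomeomorph.univBall_target (φ x) hr])
  · exact fun e => OpenPartialHomeomorph.left_inv _ (by simp)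
  · simp [φ.left_inv hxs]
  · intro e
    have he : OpenPartialHomeomorph.univBall (φ x) r e ∈ Metric.ball (φ x) r := by
      rw [← OpenPartialHomeomorph.univBall_target (φ x) hr]
      exact OpenPartialHomeomorph.map_source _ (by simp)
    obtain ⟨⟨h1, h2⟩, -⟩ := hball he
    have h1' : φ.symm (ρ (OpenPartialHomeomorph.univBall (φ x) r e)) ∈ W := h1
    have h2' : ρ (OpenPartialHomeomorph.univBall (φ x) r e) = _ := h2
    rwa [h2'] at h1'

/-- The local normal form of a submersion: near every point it is a projection in suitable
charts. -/
theorem SmoothManifoldStructure.IsSubmersion.exists_isOpenParam {Y : Type v} [DiffeologicalSpace Y]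
    {A : SmoothManifoldStructure X} {B : SmoothManifoldStructure Y} {s : X → Y}
    (hs : A.IsSubmersion B s) (x : X) :
    ∃ (k m : ℕ) (Ψ : EuclideanSpace ℝ (Fin k) × EuclideanSpace ℝ (Fin m) → X)
      (α : EuclideanSpace ℝ (Fin m) → Y), IsOpenParam Ψ ∧ IsOpenParam α ∧ Ψ 0 = x ∧ α 0 = s x ∧
        ∀ e, s (Ψ e) = α e.2 := by
  let := A.topology
  let := A.charted
  let := A.isManifold
  let := B.topology
  let := B.charted
  let := B.isManifold
  obtain ⟨F₀, _, _, h₀⟩ := hs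
  have h₁ := h₀ x
  have : FiniteDimensional ℝ (EuclideanSpace ℝ (Fin B.dim) × F₀) :=
    Module.Finite.equiv h₁.equiv.toLinearEquiv
  have : FiniteDimensional ℝ F₀ := Module.Finite.of_surjective
    (LinearMap.snd ℝ (EuclideanSpace ℝ (Fin B.dim)) F₀) LinearMap.snd_surjective
  -- A Euclidean complement is needed for the smoothness of `univBall`.
  have h := h₁.trans_F (toEuclidean (E := F₀))
  set k := Module.finrank ℝ F₀
  set φ := h.domChart
  set χ := h.codChart
  set L := h.equiv
  have hφ := h.domChart_mem_maximalAtlas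
  have hχ := h.codChart_mem_maximalAtlas
  have hx : x ∈ φ.source := h.mem_domChart_source
  have hw : ∀ y ∈ φ.target, χ (s (φ.symm y)) = (L y).1 := by
    intro y hy
    have hy' : y ∈ (φ.extend (𝓡 A.dim)).target := by simpa using hy
    simpa using h.writtenInCharts hy'
  have hmaps : ∀ y ∈ φ.target, s (φ.symm y) ∈ χ.source := fun y hy =>
    h.source_subset_preimage_source (φ.map_target hy)
  set a := (L (φ x)).1 with ha
  set b := (L (φ x)).2 with hb
  have hnhds : L.symm ⁻¹' φ.target ∈ 𝓝 (a, b) := by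
    refine L.symm.continuous.continuousAt.preimage_mem_nhds ?_
    have : L.symm (a, b) = φ x := by simp [ha, hb]
    rw [this]
    exact φ.open_target.mem_nhds (φ.map_source hx)
  obtain ⟨r, hr, hball⟩ := Metric.mem_nhds_iff.1 hnhds
  rw [← ball_prod_same] at hball
  set ua := OpenPartialHomeomorph.univBall a r
  set ub := OpenPartialHomeomorph.univBall b r
  have hua : ∀ e, ua e ∈ Metric.ball a r := fun e => by
    rw [← OpenPartialHomeomorph.univBall_target a hr]
    exact OpenPartialHomeomorph.map_source _ (by simp)
  have hub : ∀ e, ub e ∈ Metric.ball b r := fun e => by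
    rw [← OpenPartialHomeomorph.univBall_target b hr]
    exact OpenPartialHomeomorph.map_source _ (by simp)
  have hual : ∀ e, ua.symm (ua e) = e := fun e => ua.left_inv (by simp [ua])
  have hubl : ∀ e, ub.symm (ub e) = e := fun e => ub.left_inv (by simp [ub])
  have huar : ∀ y ∈ Metric.ball a r, ua (ua.symm y) = y := fun y hy =>
    ua.right_inv (by rwa [OpenPartialHomeomorph.univBall_target a hr])
  have hubr : ∀ y ∈ Metric.ball b r, ub (ub.symm y) = y := fun y hy =>
    ub.right_inv (by rwa [OpenPartialHomeomorph.univBall_target b hr])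
  have hT : L ⁻¹' (Metric.ball a r ×ˢ Metric.ball b r) ⊆ φ.target := fun y hy => by
    simpa using hball hy
  have hTa : Metric.ball a r ⊆ χ.target := fun y hy => by
    have h1 : L.symm (y, b) ∈ φ.target := hball ⟨hy, Metric.mem_ball_self hr⟩
    have h2 := hw _ h1
    rw [L.apply_symm_apply] at h2
    have h3 := χ.map_source (hmaps _ h1)
    rwa [h2] at h3
  have hσT : ∀ e : EuclideanSpace ℝ (Fin k) × EuclideanSpace ℝ (Fin B.dim),
      L.symm (ua e.2, ub e.1) ∈ L ⁻¹' (Metric.ball a r ×ˢ Metric.ball b r) := fun e => by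
    simpa using And.intro (hua e.2) (hub e.1)
  refine ⟨k, B.dim, fun e => φ.symm (L.symm (ua e.2, ub e.1)), fun e => χ.symm (ua e),
    A.isOpenParam hφ (σ := fun e => L.symm (ua e.2, ub e.1))
      (τ := fun y => (ub.symm (L y).2, ua.symm (L y).1)) ?_
      ((Metric.isOpen_ball.prod Metric.isOpen_ball).preimage L.continuous) hT hσT ?_ ?_ ?_,
    B.isOpenParam hχ (σ := ua) (τ := ua.symm) OpenPartialHomeomorph.contDiff_univBall
      Metric.isOpen_ball hTa hua OpenPartialHomeomorph.contDiffOn_univBall_symm huar hual,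
    ?_, ?_, ?_⟩
  · exact L.symm.contDiff.comp ((OpenPartialHomeomorph.contDiff_univBall.comp contDiff_snd).prodMk
      (OpenPartialHomeomorph.contDiff_univBall.comp contDiff_fst))
  · refine ContDiffOn.prodMk ?_ ?_
    · exact OpenPartialHomeomorph.contDiffOn_univBall_symm.comp
        (contDiff_snd.comp L.contDiff).contDiffOn fun y hy => hy.2
    · exact OpenPartialHomeomorph.contDiffOn_univBall_symm.comp
        (contDiff_fst.comp L.contDiff).contDiffOn fun y hy => hy.1
  · intro y hy
    rw [huar _ hy.1, hubr _ hy.2]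
    simp
  · intro e
    simp [hual, hubl]
  · have h1 : ua 0 = a := OpenPartialHomeomorph.univBall_apply_zero a r
    have h2 : ub 0 = b := OpenPartialHomeomorph.univBall_apply_zero b r
    simp only [Prod.snd_zero, Prod.fst_zero, h1, h2]
    simp [ha, hb, φ.left_inv hx]
  · have h1 : ua 0 = a := OpenPartialHomeomorph.univBall_apply_zero a r
    have h2 := hw _ (φ.map_source hx)
    have h3 := hmaps _ (φ.map_source hx)
    rw [φ.left_inv hx] at h2 h3
    simp only [h1, ha, ← h2, χ.left_inv h3]
  · intro e
    have h1 := hw _ (hT (hσT e))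
    have h2 := hmaps _ (hT (hσT e))
    rw [L.apply_symm_apply] at h1
    exact (χ.left_inv h2).symm.trans (congrArg χ.symm h1)

/-- Submersions of manifolds are local subductions. -/
theorem SmoothManifoldStructure.IsSubmersion.isLocalSubduction {Y : Type v} [DiffeologicalSpace Y]
    {A : SmoothManifoldStructure X} {B : SmoothManifoldStructure Y} {s : X → Y}
    (hs : A.IsSubmersion B s) : IsLocalSubduction s := by
  refine isLocalSubduction_of_exists_lift (fun n p hp => isPlot_of_locally fun z => ?_)
    fun n φ hφ x z hz => ?_
  · obtain ⟨k, m, Ψ, α, hΨ, hα, hx, -, hsΨ⟩ := hs.exists_isOpenParam (p z)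
    obtain ⟨ψ, hψ, -, H⟩ := hΨ.exists_lift hp hx.symm
    exact ⟨fun y => α (ψ y).2, hα.smooth (contDiff_snd.comp hψ), H.mono fun y hy => by
      rw [Function.comp_apply, hy, hsΨ]⟩
  · obtain ⟨k, m, Ψ, α, hΨ, hα, hx, hy, hsΨ⟩ := hs.exists_isOpenParam x
    obtain ⟨ξ, hξ, hξz, H⟩ := hα.exists_lift hφ (hz.trans hy.symm)
    refine ⟨fun y => Ψ (0, ξ y), hΨ.smooth (contDiff_const.prodMk hξ), ?_, H.mono fun y hy => ?_⟩
    · simp only [hξz, ← hx]; rfl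
    · rw [hy, hsΨ]

end Charts

/-! ### Quasi-étale spaces in terms of parametrizations -/

section QuasiEtale

/-- The diffeology of a lifted space. It serves to move Euclidean spaces to other universes. -/
instance uliftDiffeology {X : Type v} [DiffeologicalSpace X] :
    DiffeologicalSpace (ULift.{u} X) where
  plots _ := {p | IsPlot fun z => (p z).down}
  constant_plots x := isPlot_const (x := x.down)
  plot_reparam {_ _ p f} hp hf := isPlot_reparam (p := fun z => (p z).down) hp hf
  locality {_ p} h := DiffeologicalSpace.locality (p := fun z => (p z).down) h

theorem isPlot_ulift_iff {m n : ℕ}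
    {p : EuclideanSpace ℝ (Fin m) → ULift.{u} (EuclideanSpace ℝ (Fin n))} :
    IsPlot p ↔ ContDiff ℝ ∞ fun z => (p z).down :=
  isPlot_iff_contDiff (p := fun z => (p z).down)

theorem isSmoothManifold_ulift_euclideanSpace (n : ℕ) :
    IsSmoothManifold (ULift.{u} (EuclideanSpace ℝ (Fin n))) := by
  have hd : Topology.IsOpenEmbedding
      (ULift.down : ULift.{u} (EuclideanSpace ℝ (Fin n)) → EuclideanSpace ℝ (Fin n)) :=
    Homeomorph.ulift.isOpenEmbedding
  let := hd.singletonChartedSpace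
  have := hd.isManifold_singleton (I := 𝓡 n) (n := ∞)
  refine ⟨{ dim := n, isPlot_iff := fun {m} p => ?_ }⟩
  rw [isPlot_ulift_iff, ← contMDiff_iff_contDiff]
  constructor
  · intro h
    have h2 := contMDiffOn_isOpenEmbedding_symm (I := 𝓡 n) (n := ∞) hd
    have h3 := h2.comp_contMDiff h fun z => ⟨p z, rfl⟩
    have h4 : (hd.toOpenPartialHomeomorph _).symm ∘ (fun z => (p z).down) = p :=
      funext fun z => hd.toOpenPartialHomeomorph_left_inv
    rw [h4] at h3
    exact h3
  · intro h
    exact (contMDiff_isOpenEmbedding (I := 𝓡 n) (n := ∞) hd).comp h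

variable {X : Type u} [DiffeologicalSpace X]

/-- A quasi-étale parametrization with Euclidean domain is a quasi-étale map. -/
theorem IsQEParam.isQuasiEtale {n : ℕ} {c : EuclideanSpace ℝ (Fin n) → X} (hc : IsQEParam c) :
    IsQuasiEtale fun e : ULift.{u} (EuclideanSpace ℝ (Fin n)) => c e.down where
  localSubduction := by
    refine isLocalSubduction_of_exists_lift
      (fun m p hp => hc.smooth (isPlot_iff_contDiff.1 (show IsPlot fun z => (p z).down from hp)))
      fun m φ hφ x z h => ?_
    obtain ⟨ψ, hψ, hz, H⟩ := hc.lift hφ h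
    exact ⟨fun y => ⟨ψ y⟩, hψ.isPlot, congrArg ULift.up hz, H⟩
  fibers x m p hp h := by
    have hp' : ContDiff ℝ ∞ fun z => (p z).down := isPlot_ulift_iff.1 hp
    have hconst := hc.disc hp' fun y y' => (h y).trans (h y').symm
    exact IsLocallyConstant.of_constant p fun y y' => ULift.down_injective (hconst y y')
  rigid O hO f hf h x := by
    -- Extend `f` from a neighbourhood of `x` to a smooth self-map `F` of the Euclidean space.
    have hup : IsPlot fun y : EuclideanSpace ℝ (Fin n) =>
        (ULift.up y : ULift.{u} (EuclideanSpace ℝ (Fin n))) := isPlot_id' (n := n)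
    obtain ⟨ρ, hρ, hρO, hρx, hρe⟩ := exists_smooth_retract_nhds
      (IsPlot.preimage_mem_nhds hup hO (z := x.1.down) x.2)
    let F : EuclideanSpace ℝ (Fin n) → EuclideanSpace ℝ (Fin n) :=
      fun y => (f ⟨⟨ρ y⟩, hρO y⟩).down
    have hF : ContDiff ℝ ∞ F := isPlot_iff_contDiff.1 (hf n (fun y => ⟨⟨ρ y⟩, hρO y⟩) hρ.isPlot)
    have hcF : ∀ y, c (F y) = c (ρ y) := fun y => h ⟨⟨ρ y⟩, hρO y⟩
    obtain ⟨W, hW, hWo, hxW⟩ := mem_nhds_iff.1 hρe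
    have hWρ : ∀ y ∈ W, ρ y = y := hW
    have hinv : ∀ y ∈ W, (fderiv ℝ F y).IsInvertible := fun y hy => by
      have hinj := hc.rigid hF (Filter.mem_of_superset (hWo.mem_nhds hy)
        fun y' hy' => (hcF y').trans (congrArg c (hWρ y' hy')))
      exact ⟨(LinearEquiv.ofInjectiveEndo (fderiv ℝ F y : _ →ₗ[ℝ] _)
        hinj).toContinuousLinearEquiv, by ext; rfl⟩
    -- The inverse function theorem inverts `F` near `x`. The inverse is smooth throughout after
    -- restriction to `W`, where the derivative of `F` is invertible at every point.
    obtain ⟨T₀, hT₀⟩ := hinv _ hxW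
    have hxd : HasFDerivAt F (T₀ : _ →L[ℝ] _) x.1.down := by
      rw [hT₀]; exact (hF.differentiable (by simp) _).hasFDerivAt
    let e₀ := hF.contDiffAt.toOpenPartialHomeomorph F hxd (by simp)
    have he₀ : ∀ y, e₀ y = F y := fun y => rfl
    have hxe : x.1.down ∈ e₀.source :=
      hF.contDiffAt.mem_toOpenPartialHomeomorph_source hxd (by simp)
    let e₁ := e₀.restrOpen W hWo
    have he₁ : ∀ y, e₁ y = F y := fun y => rfl
    have hsrc : e₁.source = e₀.source ∩ W := e₀.restrOpen_source W hWo
    have hfF : ∀ y : {x // x ∈ O}, y.1.down ∈ W → (f y).down = F y.1.down := fun y hy => by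
      have : (⟨⟨ρ y.1.down⟩, hρO _⟩ : {x // x ∈ O}) = y :=
        Subtype.ext (ULift.down_injective (hWρ _ hy))
      exact congrArg (fun a => (f a).down) this.symm
    have hWO : ∀ y ∈ W, (⟨y⟩ : ULift.{u} (EuclideanSpace ℝ (Fin n))) ∈ O := fun y hy => by
      have : ULift.up (ρ y) ∈ O := hρO y
      rwa [hWρ y hy] at this
    have hsymm : ContDiffOn ℝ ∞ e₁.symm e₁.target := fun y hy => by
      have hm := e₁.map_target hy
      rw [hsrc] at hm
      obtain ⟨T, hT⟩ := hinv _ hm.2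
      refine (e₁.contDiffAt_symm (f₀' := T) hy ?_ hF.contDiffAt).contDiffWithinAt
      rw [hT]
      exact (hF.differentiable (by simp) _).hasFDerivAt
    have hmem : ∀ y ∈ e₁.target, e₁.symm y ∈ W := fun y hy => by
      have hm := e₁.map_target hy
      rw [hsrc] at hm
      exact hm.2
    refine ⟨{y | y.1.down ∈ e₁.source}, {y | y.down ∈ e₁.target}, ?_, ?_, ?_, ?_⟩
    · rw [isOpen_iff_preimages_plots]
      intro m p hp
      have hp' : ContDiff ℝ ∞ fun z => (p z).1.down := isPlot_ulift_iff.1 hp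
      exact e₁.open_source.preimage hp'.continuous
    · exact hsrc ▸ ⟨hxe, hxW⟩
    · rw [isOpen_iff_preimages_plots]
      intro m p hp
      have hp' : ContDiff ℝ ∞ fun z => (p z).down := isPlot_ulift_iff.1 hp
      exact e₁.open_target.preimage hp'.continuous
    · have hsW : ∀ y ∈ e₁.source, y ∈ W := fun y hy => by
        rw [hsrc] at hy
        exact hy.2
      refine ⟨⟨fun y => ⟨f y.1, ?_⟩, fun y => ⟨⟨⟨e₁.symm y.1.down⟩, hWO _ (hmem _ y.2)⟩, ?_⟩,
        fun y => ?_, fun y => ?_⟩, ?_, ?_, fun y => rfl⟩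
      · have h1 := e₁.map_source y.2
        rw [he₁, ← hfF y.1 (hsW _ y.2)] at h1
        exact h1
      · exact e₁.map_target y.2
      · apply Subtype.ext
        apply Subtype.ext
        apply ULift.down_injective
        change e₁.symm (f y.1).down = y.1.1.down
        rw [hfF y.1 (hsW _ y.2), ← he₁, e₁.left_inv y.2]
      · apply Subtype.ext
        apply ULift.down_injective
        refine (hfF _ (hmem _ y.2)).trans ?_
        exact e₁.right_inv y.2
      · exact fun m p hp => hf m (fun z => (p z).1) hp
      · intro m p hp
        have hp' : ContDiff ℝ ∞ fun z => (p z).1.down := isPlot_ulift_iff.1 hp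
        exact (hsymm.comp_contDiff hp' fun z => (p z).2).isPlot

/-- A quasi-étale map from a manifold, composed with the inverse of a chart. -/
theorem IsQuasiEtale.isQEParam_comp {V : Type v} [DiffeologicalSpace V] {π : V → X}
    (hπ : IsQuasiEtale π) {n : ℕ} {κ : EuclideanSpace ℝ (Fin n) → V} (hκ : IsOpenParam κ) :
    IsQEParam fun e => π (κ e) where
  smooth _ _ hψ := hπ.localSubduction.1 _ _ (hκ.smooth hψ)
  lift m p hp z e h := by
    obtain ⟨ψ, hψ, hψz, H⟩ := hπ.localSubduction.exists_lift hp h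
    obtain ⟨ξ, hξ, hξz, H'⟩ := hκ.exists_lift hψ hψz
    exact ⟨ξ, hξ, hξz, by filter_upwards [H, H'] with y h1 h2; rw [h1, h2]⟩
  disc m γ hγ h y y' := by
    refine hκ.injective ?_
    exact (hπ.fibers (π (κ (γ 0))) m (fun z => κ (γ z)) (hκ.smooth hγ)
      fun z => h z 0).apply_eq_of_isPreconnected isPreconnected_univ trivial trivial
  rigid F hF z h := by
    obtain ⟨B, hB, hBo, hzB⟩ := mem_nhds_iff.1 h
    -- The self-map `κ y ↦ κ (F y)` of the open set `κ '' B`.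
    let g : {x // x ∈ κ '' B} → V := fun x => κ (F x.2.choose)
    have hg : ∀ y (hy : κ y ∈ κ '' B), g ⟨κ y, hy⟩ = κ (F y) := fun y hy =>
      congrArg (fun a => κ (F a)) (hκ.injective hy.choose_spec.2)
    have hO : IsOpen[dTopology] (κ '' B) := by
      rw [isOpen_iff_preimages_plots]
      intro m p hp
      rw [isOpen_iff_mem_nhds]
      rintro y ⟨b, hb, hpb⟩
      obtain ⟨ψ, hψ, hψy, H⟩ := hκ.exists_lift hp hpb.symm
      have hBψ : ∀ᶠ y' in 𝓝 y, ψ y' ∈ B :=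
        hψ.continuous.continuousAt.eventually_mem (hBo.mem_nhds (hψy ▸ hb))
      filter_upwards [H, hBψ] with y' h1 h2
      exact ⟨ψ y', h2, h1.symm⟩
    have hgs : DSmooth g := by
      intro m p hp
      obtain ⟨ψ, hψ, H⟩ := hκ.lift (p := fun y => (p y).1) hp fun y => by
        obtain ⟨b, -, hb⟩ := (p y).2
        exact ⟨b, hb⟩
      have : g ∘ p = fun y => κ (F (ψ y)) := by
        funext y
        have hm : κ (ψ y) ∈ κ '' B := H y ▸ (p y).2
        rw [← hg _ hm]
        exact congrArg g (Subtype.ext (H y))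
      rw [this]
      exact hκ.smooth (hF.comp hψ)
    have hgπ : ∀ x, π (g x) = π x := by
      rintro ⟨_, b, hb, rfl⟩
      rw [hg b ⟨b, hb, rfl⟩]
      exact hB hb
    obtain ⟨U, U', hU, hzU, hU', e, he, he', hef⟩ :=
      hπ.rigid _ hO g hgs hgπ ⟨κ z, z, hzB, rfl⟩
    -- The local inverse of that self-map, expressed in the chart as a map `H`.
    have hFz : κ (F z) ∈ U' := by
      have h1 := (e ⟨⟨κ z, z, hzB, rfl⟩, hzU⟩).2
      rwa [hef, hg z ⟨z, hzB, rfl⟩] at h1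
    have hid : IsPlot κ := hκ.smooth contDiff_id
    obtain ⟨ρ, hρ, hρU, hρz, hρe⟩ := exists_smooth_retract_nhds
      (IsPlot.preimage_mem_nhds hid hU' hFz)
    have hq : IsPlot fun y => ((e.symm ⟨κ (ρ y), hρU y⟩).1 : V) :=
      he' n (fun y => ⟨κ (ρ y), hρU y⟩) (hκ.smooth hρ)
    obtain ⟨H, hH, hHe⟩ := hκ.lift hq fun y => by
      obtain ⟨b, -, hb⟩ := (e.symm ⟨κ (ρ y), hρU y⟩).1.2
      exact ⟨b, hb⟩
    refine fderiv_injective_of_eventually_leftInverse (g := H) (hF.differentiable (by simp) z)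
      (hH.differentiable (by simp) _) ?_
    have h1 : ∀ᶠ y in 𝓝 z, ρ (F y) = F y :=
      hF.continuous.continuousAt.eventually hρe
    have hBm : ∀ᶠ y in 𝓝 z, y ∈ B := hBo.mem_nhds hzB
    obtain ⟨ρ', hρ', hρB', hρz', hρe'⟩ := exists_smooth_retract_nhds (hBo.mem_nhds hzB)
    have h2 := IsPlot.preimage_mem_nhds (p := fun y => (⟨κ (ρ' y), ρ' y, hρB' y, rfl⟩ :
      {x // x ∈ κ '' B})) (hκ.smooth hρ') hU (z := z) (by simpa only [hρz'] using hzU)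
    filter_upwards [h1, hBm, hρe', h2] with y h1 hyB h3 h2
    have h2' : (⟨κ y, y, hyB, rfl⟩ : {x // x ∈ κ '' B}) ∈ U := by simpa only [h3] using h2
    apply hκ.injective
    rw [← hHe]
    have h4 : (⟨κ (ρ (F y)), hρU _⟩ : {x // x ∈ U'}) = e ⟨⟨κ y, y, hyB, rfl⟩, h2'⟩ := by
      apply Subtype.ext
      rw [hef, hg y ⟨y, hyB, rfl⟩]
      exact congrArg κ h1
    rw [h4, e.symm_apply_apply]

theorem isQUED_of_exists_isQEParam (h : ∀ x : X, ∃ (n : ℕ) (c : EuclideanSpace ℝ (Fin n) → X),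
    IsQEParam c ∧ x ∈ Set.range c) : IsQUED X := by
  intro x
  obtain ⟨n, c, hc, z, hz⟩ := h x
  exact ⟨ULift.{u} (EuclideanSpace ℝ (Fin n)), inferInstance,
    isSmoothManifold_ulift_euclideanSpace n, _, hc.isQuasiEtale, ⟨z⟩, hz⟩

/-- A quasi-étale space has quasi-étale parametrizations inside every D-neighbourhood. -/
theorem IsQUED.exists_isQEParam (h : IsQUED X) {W : Set X} (hW : IsOpen[dTopology] W) {x : X}
    (hx : x ∈ W) : ∃ (n : ℕ) (c : EuclideanSpace ℝ (Fin n) → X),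
      IsQEParam c ∧ c 0 = x ∧ ∀ e, c e ∈ W := by
  obtain ⟨V, _, ⟨A⟩, π, hπ, v, rfl⟩ := h x
  have hW' : IsOpen[dTopology] (π ⁻¹' W) := by
    rw [isOpen_iff_preimages_plots] at hW ⊢
    exact fun m p hp => hW m _ (hπ.localSubduction.1 m p hp)
  obtain ⟨κ, hκ, hκ0, hκW⟩ := A.exists_isOpenParam hW' (x := v) hx
  exact ⟨_, _, hπ.isQEParam_comp hκ, by rw [hκ0], hκW⟩

theorem IsSmoothManifold.isQUED (h : IsSmoothManifold X) : IsQUED X := by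
  obtain ⟨A⟩ := h
  refine isQUED_of_exists_isQEParam fun x => ?_
  obtain ⟨κ, hκ, hx, -⟩ := A.exists_isOpenParam (W := Set.univ) (x := x)
    (isOpen_iff_preimages_plots.2 fun _ _ _ => isOpen_univ) trivial
  exact ⟨_, κ, hκ.isQEParam, 0, hx⟩

theorem IsQUED.of_diffeo {Y : Type u} [DiffeologicalSpace Y] (h : IsQUED X) (e : X ≃ Y)
    (he : DSmooth e) (he' : DSmooth e.symm) : IsQUED Y := by
  refine isQUED_of_exists_isQEParam fun y => ?_
  obtain ⟨n, c, hc, hx, -⟩ := h.exists_isQEParam (W := Set.univ) (x := e.symm y)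
    (isOpen_iff_preimages_plots.2 fun _ _ _ => isOpen_univ) trivial
  exact ⟨n, _, hc.comp_diffeo e he he', 0, by simp [hx]⟩

end QuasiEtale

/-! ### The quotient of a Lie groupoid and its fibre products -/

namespace GroupoidStructure

variable {G M : Type u} [DiffeologicalSpace G] [DiffeologicalSpace M] {𝒢 : GroupoidStructure G M}

theorem IsLieGroupoid.isPlot_comp (h𝒢 : 𝒢.IsLieGroupoid) {n : ℕ}
    {p q : EuclideanSpace ℝ (Fin n) → G} (hp : IsPlot p) (hq : IsPlot q)
    (w : ∀ y, 𝒢.src (p y) = 𝒢.tgt (q y)) : IsPlot fun y => 𝒢.comp (p y) (q y) (w y) :=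
  h𝒢.mul_smooth n (fun y => ⟨(p y, q y), w y⟩) ⟨hp, hq⟩

theorem IsLieGroupoid.src_isLocalSubduction (h𝒢 : 𝒢.IsLieGroupoid) : IsLocalSubduction 𝒢.src := by
  obtain ⟨A, B, hs, -⟩ := h𝒢.submersion
  exact hs.isLocalSubduction

theorem IsLieGroupoid.tgt_isLocalSubduction (h𝒢 : 𝒢.IsLieGroupoid) : IsLocalSubduction 𝒢.tgt := by
  obtain ⟨A, B, -, ht⟩ := h𝒢.submersion
  exact ht.isLocalSubduction

namespace WideNormalSubgroupoid

variable {N : 𝒢.WideNormalSubgroupoid}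

/-- The projection to the quotient is a local subduction: a local lift of a plot can be moved to a
prescribed point of the coset by multiplying it with a plot of the subgroupoid. -/
theorem isLocalSubduction_mk (h𝒢 : 𝒢.IsLieGroupoid) (hiso : N.IsIsotropic)
    (hsub : IsLocalSubduction fun n : {g // g ∈ N.carrier} => 𝒢.src n) :
    IsLocalSubduction (Quotient.mk N.setoid) := by
  refine isLocalSubduction_of_exists_lift (dSmooth_quotient_mk N.setoid) fun m φ hφ g z h => ?_
  obtain ⟨V, hV, hz, q, hq, hφq⟩ := hφ z
  obtain ⟨n, hn, w, hqn⟩ := Quotient.exact ((hφq z hz).symm.trans h)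
  obtain ⟨ν, hν, hνz, H⟩ := hsub.exists_lift (h𝒢.src_isLocalSubduction.1 m q hq)
    (x := ⟨n, hn⟩) (z := z) (w.trans (hiso n hn).symm)
  obtain ⟨ρ, hρ, hρU, hρz, hρe⟩ :=
    exists_smooth_retract_nhds (Filter.inter_mem (hV.mem_nhds hz) H)
  have w' : ∀ y, 𝒢.src (q (ρ y)) = 𝒢.tgt (ν (ρ y) : G) := fun y =>
    (hρU y).2.trans (hiso _ (ν (ρ y)).2)
  refine ⟨fun y => 𝒢.comp (q (ρ y)) (ν (ρ y)) (w' y),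
    h𝒢.isPlot_comp (isPlot_reparam hq hρ) (isPlot_reparam (p := fun y => (ν y : G)) hν hρ) w',
    ?_, hρe.mono fun y hy => ?_⟩
  · have hνz' : (ν (ρ z) : G) = n := by rw [hρz, hνz]
    exact (𝒢.comp_congr (congrArg q hρz) hνz' _).trans hqn
  · exact (congrArg φ hy).symm.trans
      ((hφq _ (hρU y).1).trans (Quotient.sound ⟨_, (ν (ρ y)).2, w' y, rfl⟩))

/-- If two plots `p`, `q` represent the same cosets and `p` takes values in one source fibre, then
they differ by right translation with a single element: the quotient `q⁻¹ p` is a plot of a totally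
disconnected set. -/
theorem exists_right_translation (h𝒢 : 𝒢.IsLieGroupoid)
    (hdisc : ∀ x : M, IsDiffTotallyDisconnected {g | g ∈ N.carrier ∧ 𝒢.src g = x}) {m : ℕ}
    {p q : EuclideanSpace ℝ (Fin m) → G} (hp : IsPlot p) (hq : IsPlot q)
    (h : ∀ y, Quotient.mk N.setoid (q y) = Quotient.mk N.setoid (p y))
    (hs : ∀ y y', 𝒢.src (p y) = 𝒢.src (p y')) :
    ∃ (n : G) (w : ∀ y, 𝒢.src (q y) = 𝒢.tgt n), ∀ y, 𝒢.comp (q y) n (w y) = p y := by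
  have w₀ : ∀ y, 𝒢.src (𝒢.inv (q y)) = 𝒢.tgt (p y) := fun y => by
    rw [𝒢.src_inv]
    exact rel_tgt (Quotient.exact (h y))
  let ν : EuclideanSpace ℝ (Fin m) → G := fun y => 𝒢.comp (𝒢.inv (q y)) (p y) (w₀ y)
  have hν : IsPlot ν := h𝒢.isPlot_comp (h𝒢.inv_smooth _ _ hq) hp w₀
  have hνN : ∀ y, ν y ∈ N.carrier := fun y => by
    obtain ⟨n, hn, w, e⟩ := Quotient.exact (h y)
    have : ν y = n := (𝒢.comp_congr rfl e.symm _).trans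
      (𝒢.inv_comp_cancel _ _ w (by rw [𝒢.tgt_comp, 𝒢.src_inv]))
    rwa [this]
  have hconst : ∀ y, ν y = ν 0 := fun y =>
    (hdisc (𝒢.src (p 0)) m ν hν fun y => ⟨hνN y,
      (𝒢.src_comp _ _ _).trans (hs y 0)⟩).apply_eq_of_isPreconnected isPreconnected_univ
        trivial trivial
  have w : ∀ y, 𝒢.src (q y) = 𝒢.tgt (ν y) := fun y => by rw [𝒢.tgt_comp, 𝒢.tgt_inv]
  exact ⟨ν 0, fun y => hconst y ▸ w y, fun y =>
    (𝒢.comp_congr rfl (hconst y).symm _).trans (𝒢.comp_inv_cancel _ _ (w₀ y) (w y))⟩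

/-- Plots of the arrow space that lie in one coset are constant. -/
theorem eq_of_mk_eq (h𝒢 : 𝒢.IsLieGroupoid) (hiso : N.IsIsotropic)
    (hdisc : ∀ x : M, IsDiffTotallyDisconnected {g | g ∈ N.carrier ∧ 𝒢.src g = x}) {m : ℕ}
    {p : EuclideanSpace ℝ (Fin m) → G} (hp : IsPlot p)
    (h : ∀ y y', Quotient.mk N.setoid (p y) = Quotient.mk N.setoid (p y'))
    (y y' : EuclideanSpace ℝ (Fin m)) : p y = p y' := by
  obtain ⟨n, w, hn⟩ := exists_right_translation h𝒢 hdisc hp (isPlot_const (x := p 0))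
    (fun y => h 0 y) fun y y' => rel_src hiso (Quotient.exact (h y y'))
  rw [← hn y, ← hn y']

/-- The quasi-étale parametrization `(b, v) ↦ (Ψ(b, a(v)) N, χ(v))` of the fibre product of the
source map of `G/N` with a map `f`, where `Ψ` is a chart of `G` in which the source map is the
projection `(b, x) ↦ α(x)`, and `a` is the expression of `f` in the charts `χ` and `α`.

Let `F` be a self-map over the fibre product. Along the fibre variable `b`, its second component is
constant, and its first component is right translation by a fixed arrow, which is invertible. Along
the variable `v`, its second component is a self-map over `χ`. Hence the derivative of `F` is block
triangular with injective diagonal blocks. -/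
theorem isQEParam_fibreProduct (h𝒢 : 𝒢.IsLieGroupoid) (hiso : N.IsIsotropic)
    (hsub : IsLocalSubduction fun n : {g // g ∈ N.carrier} => 𝒢.src n)
    (hdisc : ∀ x : M, IsDiffTotallyDisconnected {g | g ∈ N.carrier ∧ 𝒢.src g = x})
    {Y : Type v} [DiffeologicalSpace Y] {f : Y → M} {k m d : ℕ}
    {Ψ : EuclideanSpace ℝ (Fin k) × EuclideanSpace ℝ (Fin m) → G}
    {α : EuclideanSpace ℝ (Fin m) → M} {χ : EuclideanSpace ℝ (Fin d) → Y}
    {a : EuclideanSpace ℝ (Fin d) → EuclideanSpace ℝ (Fin m)}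
    (hΨ : IsOpenParam Ψ) (hα : IsOpenParam α) (hΨα : ∀ e, 𝒢.src (Ψ e) = α e.2)
    (hχ : IsQEParam χ) (ha : ContDiff ℝ ∞ a) (hfa : ∀ v, f (χ v) = α (a v)) :
    IsQEParam fun e : EuclideanSpace ℝ (Fin k) × EuclideanSpace ℝ (Fin d) =>
      (⟨(Quotient.mk N.setoid (Ψ (e.1, a e.2)), χ e.2), (hΨα _).trans (hfa _).symm⟩ :
        {b : N.Quot × Y // quotSrc hiso b.1 = f b.2}) where
  smooth n ψ hψ := by
    refine ⟨?_, hχ.smooth (contDiff_snd.comp hψ)⟩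
    exact dSmooth_quotient_mk N.setoid _ _ (hΨ.smooth (ψ := fun y => ((ψ y).1, a (ψ y).2))
      ((contDiff_fst.comp hψ).prodMk (ha.comp (contDiff_snd.comp hψ))))
  lift n p hp z e h := by
    have h₁ : (p z).1.1 = Quotient.mk N.setoid (Ψ (e.1, a e.2)) := congrArg (fun x => x.1.1) h
    have h₂ : (p z).1.2 = χ e.2 := congrArg (fun x => x.1.2) h
    obtain ⟨η, hη, hηz, Hη⟩ := hχ.lift hp.2 h₂
    obtain ⟨q, hq, hqz, Hq⟩ := (isLocalSubduction_mk h𝒢 hiso hsub).exists_lift hp.1 h₁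
    obtain ⟨ψ, hψ, hψz, Hψ⟩ := hΨ.exists_lift hq hqz
    refine ⟨fun y => ((ψ y).1, η y), (contDiff_fst.comp hψ).prodMk hη, by simp [hψz, hηz], ?_⟩
    filter_upwards [Hη, Hq, Hψ] with y h1 h2 h3
    have h4 : (ψ y).2 = a (η y) := by
      apply hα.injective
      rw [← hΨα, ← h3, ← hfa, ← h1, ← (p y).2, h2]
      rfl
    refine Subtype.ext (Prod.ext ?_ h1)
    exact h2.trans (congrArg _ (h3.trans (congrArg Ψ (Prod.ext rfl h4))))
  disc n γ hγ h y y' := by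
    have h₂ : ∀ y y', (γ y).2 = (γ y').2 :=
      hχ.disc (contDiff_snd.comp hγ) fun y y' => congrArg (fun x => x.1.2) (h y y')
    have h₁ := eq_of_mk_eq h𝒢 hiso hdisc (hΨ.smooth (ψ := fun y => ((γ y).1, a (γ y).2))
      ((contDiff_fst.comp hγ).prodMk (ha.comp (contDiff_snd.comp hγ))))
      (fun y y' => congrArg (fun x => x.1.1) (h y y')) y y'
    exact Prod.ext (Prod.ext_iff.1 (hΨ.injective h₁)).1 (h₂ y y')
  rigid F hF e h := by
    obtain ⟨b₀, v₀⟩ := e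
    have hFd : Differentiable ℝ F := hF.differentiable (by simp)
    have hleft : ContDiff ℝ ∞ fun b : EuclideanSpace ℝ (Fin k) => F (b, v₀) :=
      hF.comp (contDiff_id.prodMk contDiff_const)
    have hright : ContDiff ℝ ∞ fun v : EuclideanSpace ℝ (Fin d) => F (b₀, v) :=
      hF.comp (contDiff_const.prodMk contDiff_id)
    have hcl : Continuous fun b : EuclideanSpace ℝ (Fin k) => (b, v₀) := by fun_prop
    have hcr : Continuous fun v : EuclideanSpace ℝ (Fin d) => (b₀, v) := by fun_prop
    have h' : ∀ᶠ y in 𝓝 (b₀, v₀), Quotient.mk N.setoid (Ψ ((F y).1, a (F y).2)) =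
        Quotient.mk N.setoid (Ψ (y.1, a y.2)) ∧ χ (F y).2 = χ y.2 :=
      h.mono fun y hy => ⟨congrArg (fun x => x.1.1) hy, congrArg (fun x => x.1.2) hy⟩
    -- Reparametrize by `ρ` so that the relation between `F` and the identity holds on all of the
    -- fibre variable.
    obtain ⟨ρ, hρ, hρU, hρz, hρe⟩ := exists_smooth_retract_nhds ((hcl.tendsto b₀).eventually h')
    have h₂₁ : ∀ b, (F (ρ b, v₀)).2 = (F (b₀, v₀)).2 := fun b => by
      have := hχ.disc (γ := fun b => (F (ρ b, v₀)).2) (contDiff_snd.comp (hleft.comp hρ))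
        (fun y y' => (hρU y).2.trans (hρU y').2.symm) b b₀
      rwa [hρz] at this
    refine fderiv_injective_of_triangular (hFd _) ?_ ?_ (hρe.mono fun b hb => by
      rw [← h₂₁ b, hb])
    · -- The arrow `n` by which `F` translates the fibre through `(b₀, v₀)`.
      obtain ⟨n, w, hn⟩ := exists_right_translation h𝒢 hdisc
        (p := fun b => Ψ (ρ b, a v₀)) (q := fun b => Ψ ((F (ρ b, v₀)).1, a (F (b₀, v₀)).2))
        (hΨ.smooth (hρ.prodMk contDiff_const))
        (hΨ.smooth ((contDiff_fst.comp (hleft.comp hρ)).prodMk contDiff_const))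
        (fun b => by
          rw [← h₂₁ b]
          exact (hρU b).1)
        (fun b b' => by rw [hΨα, hΨα])
      have w' : ∀ b, 𝒢.src (Ψ (b, a (F (b₀, v₀)).2)) = 𝒢.tgt n := fun b => by
        rw [← w b₀, hΨα, hΨα]
      -- Right translation by `n` in the chart, a left inverse of the first component of `F`.
      obtain ⟨ψ, hψ, hψz, H⟩ := hΨ.exists_lift (h𝒢.isPlot_comp
        (hΨ.smooth (ψ := fun b : EuclideanSpace ℝ (Fin k) => (b, a (F (b₀, v₀)).2))
          (contDiff_id.prodMk contDiff_const)) (isPlot_const (x := n)) w')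
        (z := (F (b₀, v₀)).1) (e := (b₀, a v₀)) (by
          have := hn b₀
          simp only [hρz] at this
          exact this)
      refine fderiv_injective_of_eventually_leftInverse (g := fun b => (ψ b).1)
        ((contDiff_fst.comp hleft).differentiable (by simp) _)
        ((contDiff_fst.comp hψ).differentiable (by simp) _) ?_
      have hc : ContinuousAt (fun b => (F (b, v₀)).1) b₀ :=
        (contDiff_fst.comp hleft).continuous.continuousAt
      filter_upwards [hc.eventually H, hρe] with b hb hρb
      have h5 := hn b
      simp only [hρb] at h5
      exact congrArg Prod.fst (hΨ.injective (hb.symm.trans h5))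
    · refine hχ.rigid (contDiff_snd.comp hright) ?_
      exact ((hcr.tendsto v₀).eventually h').mono fun v hv => hv.2

theorem isQUED_fibreProduct_quotSrc (h𝒢 : 𝒢.IsLieGroupoid) (hiso : N.IsIsotropic)
    (hsub : IsLocalSubduction fun n : {g // g ∈ N.carrier} => 𝒢.src n)
    (hdisc : ∀ x : M, IsDiffTotallyDisconnected {g | g ∈ N.carrier ∧ 𝒢.src g = x})
    {Y : Type u} [DiffeologicalSpace Y] (hY : IsQUED Y) {f : Y → M} (hf : DSmooth f) :
    IsQUED {b : N.Quot × Y // quotSrc hiso b.1 = f b.2} := by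
  refine isQUED_of_exists_isQEParam ?_
  rintro ⟨⟨q, y⟩, hqy⟩
  induction q using Quotient.ind with | _ g
  have hgy : 𝒢.src g = f y := hqy
  obtain ⟨A, B, hs, -⟩ := h𝒢.submersion
  obtain ⟨k, m, Ψ, α, hΨ, hα, hΨ0, hα0, hΨα⟩ := hs.exists_isOpenParam g
  have hW : IsOpen[dTopology] (f ⁻¹' Set.range α) := by
    rw [isOpen_iff_preimages_plots]
    exact fun n p hp => isOpen_iff_preimages_plots.1 hα.isOpen_range n _ (hf n p hp)
  obtain ⟨d, χ, hχ, hχ0, hχW⟩ := hY.exists_isQEParam hW (x := y) ⟨0, hα0.trans hgy⟩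
  obtain ⟨a, ha, hfa⟩ := hα.lift (hf d χ (hχ.smooth contDiff_id)) hχW
  have hc := isQEParam_fibreProduct h𝒢 hiso hsub hdisc hΨ hα hΨα hχ ha hfa
  have ha0 : a 0 = 0 := hα.injective <| by
    rw [← hfa, hα0, hgy, Function.comp_apply, hχ0]
  let L : EuclideanSpace ℝ (Fin (Module.finrank ℝ
      (EuclideanSpace ℝ (Fin k) × EuclideanSpace ℝ (Fin d)))) ≃L[ℝ]
      EuclideanSpace ℝ (Fin k) × EuclideanSpace ℝ (Fin d) := toEuclidean.symm
  refine ⟨_, _, hc.comp_continuousLinearEquiv L, 0, Subtype.ext (Prod.ext ?_ ?_)⟩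
  · simp only [map_zero, Prod.fst_zero, Prod.snd_zero, ha0]
    exact congrArg _ hΨ0
  · simp only [map_zero, Prod.snd_zero, hχ0]

theorem dSmooth_quotSrc (h𝒢 : 𝒢.IsLieGroupoid) (hiso : N.IsIsotropic) :
    DSmooth (quotSrc hiso) := fun n p hp => isPlot_of_locally fun z => by
  obtain ⟨V, hV, hz, q, hq, h⟩ := hp z
  exact ⟨_, h𝒢.src_isLocalSubduction.1 n q hq, Filter.mem_of_superset (hV.mem_nhds hz)
    fun y hy => by simp only [Set.mem_ofPred_eq, Function.comp_apply, h y hy]; rfl⟩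

theorem dSmooth_quotTgt (h𝒢 : 𝒢.IsLieGroupoid) : DSmooth N.quotTgt := fun n p hp =>
    isPlot_of_locally fun z => by
  obtain ⟨V, hV, hz, q, hq, h⟩ := hp z
  exact ⟨_, h𝒢.tgt_isLocalSubduction.1 n q hq, Filter.mem_of_superset (hV.mem_nhds hz)
    fun y hy => by simp only [Set.mem_ofPred_eq, Function.comp_apply, h y hy]; rfl⟩

theorem dSmooth_quotInv (h𝒢 : 𝒢.IsLieGroupoid) (hiso : N.IsIsotropic) :
    DSmooth (quotInv hiso) := fun n p hp => isPlot_of_locally fun z => by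
  obtain ⟨V, hV, hz, q, hq, h⟩ := hp z
  exact ⟨_, dSmooth_quotient_mk N.setoid _ _ (h𝒢.inv_smooth n q hq),
    Filter.mem_of_superset (hV.mem_nhds hz)
    fun y hy => by simp only [Set.mem_ofPred_eq, Function.comp_apply, h y hy]; rfl⟩

theorem dSmooth_quotMul (h𝒢 : 𝒢.IsLieGroupoid) (hiso : N.IsIsotropic) :
    DSmooth (quotMul hiso) := fun n p hp => isPlot_of_locally fun z => by
  obtain ⟨V₁, hV₁, hz₁, q₁, hq₁, h₁⟩ := hp.1 z
  obtain ⟨V₂, hV₂, hz₂, q₂, hq₂, h₂⟩ := hp.2 z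
  obtain ⟨ρ, hρ, hρU, hρz, hρe⟩ := exists_smooth_retract_nhds
    (Filter.inter_mem (hV₁.mem_nhds hz₁) (hV₂.mem_nhds hz₂))
  have w : ∀ y, 𝒢.src (q₁ (ρ y)) = 𝒢.tgt (q₂ (ρ y)) := fun y =>
    (congrArg (quotSrc hiso) (h₁ _ (hρU y).1)).symm.trans
      ((p (ρ y)).2.trans (congrArg N.quotTgt (h₂ _ (hρU y).2)))
  refine ⟨_, dSmooth_quotient_mk N.setoid _ _
    (h𝒢.isPlot_comp (isPlot_reparam hq₁ hρ) (isPlot_reparam hq₂ hρ) w),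
    hρe.mono fun y hy => ?_⟩
  refine Eq.trans ?_ (quotMul_mk hiso _ _ (w y))
  refine congrArg (quotMul hiso) (Subtype.ext (Prod.ext ?_ ?_))
  · exact (congrArg (fun y => (p y).1.1) hy).symm.trans (h₁ _ (hρU y).1)
  · exact (congrArg (fun y => (p y).1.2) hy).symm.trans (h₂ _ (hρU y).2)

/-- Inversion of `G/N` as an involution. -/
def quotInvEquiv (hiso : N.IsIsotropic) : N.Quot ≃ N.Quot where
  toFun := quotInv hiso
  invFun := quotInv hiso
  left_inv a := by
    induction a using Quotient.ind
    exact congrArg _ (𝒢.inv_inv _)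
  right_inv a := by
    induction a using Quotient.ind
    exact congrArg _ (𝒢.inv_inv _)

/-- Inversion identifies the fibre products with the source and the target map of `G/N`. -/
theorem isQUED_fibreProduct_quotTgt (h𝒢 : 𝒢.IsLieGroupoid) (hiso : N.IsIsotropic)
    (hsub : IsLocalSubduction fun n : {g // g ∈ N.carrier} => 𝒢.src n)
    (hdisc : ∀ x : M, IsDiffTotallyDisconnected {g | g ∈ N.carrier ∧ 𝒢.src g = x})
    {Y : Type u} [DiffeologicalSpace Y] (hY : IsQUED Y) {f : Y → M} (hf : DSmooth f) :
    IsQUED {b : N.Quot × Y // N.quotTgt b.1 = f b.2} :=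
  (isQUED_fibreProduct_quotSrc h𝒢 hiso hsub hdisc hY hf).of_diffeo
    (((quotInvEquiv hiso).prodCongr (Equiv.refl Y)).subtypeEquiv fun b =>
      Iff.of_eq (congrArg (· = f b.2) ((N.quotientGroupoid hiso).tgt_inv b.1).symm))
    (fun n _ hp => ⟨dSmooth_quotInv h𝒢 hiso n _ hp.1, hp.2⟩)
    (fun n _ hp => ⟨dSmooth_quotInv h𝒢 hiso n _ hp.1, hp.2⟩)

/-- The arrow space is its own fibre product with the identity of the base. -/
theorem isQUED_quot (h𝒢 : 𝒢.IsLieGroupoid) (hM : IsQUED M) (hiso : N.IsIsotropic)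
    (hsub : IsLocalSubduction fun n : {g // g ∈ N.carrier} => 𝒢.src n)
    (hdisc : ∀ x : M, IsDiffTotallyDisconnected {g | g ∈ N.carrier ∧ 𝒢.src g = x}) :
    IsQUED N.Quot :=
  (isQUED_fibreProduct_quotSrc h𝒢 hiso hsub hdisc hM dSmooth_id').of_diffeo
    { toFun := fun b => b.1.1
      invFun := fun a => ⟨(a, quotSrc hiso a), rfl⟩
      left_inv := fun b => Subtype.ext (Prod.ext rfl b.2)
      right_inv := fun _ => rfl }
    (fun _ _ hp => hp.1) (fun n p hp => ⟨hp, dSmooth_quotSrc h𝒢 hiso n p hp⟩)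

end WideNormalSubgroupoid

end GroupoidStructure

/-! ### Submersions in the category of quasi-étale spaces -/

/-- If the diffeological fibre product is quasi-étale, it is a fibre product in the category. -/
theorem QUED.hasPullback_of_isQUED {X Y Z : QUED.{u}} (p : X ⟶ Z) (f : Y ⟶ Z)
    (h : IsQUED {b : X.carrier × Y.carrier // p.1 b.1 = f.1 b.2}) :
    CategoryTheory.Limits.HasPullback p f := by
  let P : QUED.{u} := ⟨{b : X.carrier × Y.carrier // p.1 b.1 = f.1 b.2}, h⟩
  let fst : P ⟶ X := ⟨fun b => b.1.1, fun _ _ hp => hp.1⟩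
  let snd : P ⟶ Y := ⟨fun b => b.1.2, fun _ _ hp => hp.2⟩
  have eq : CategoryTheory.CategoryStruct.comp fst p = CategoryTheory.CategoryStruct.comp snd f :=
    Subtype.ext (funext fun b => b.2)
  refine ⟨⟨⟨_, CategoryTheory.Limits.PullbackCone.IsLimit.mk eq
    (fun s => ⟨fun w => ⟨(s.fst.1 w, s.snd.1 w), congrFun (congrArg Subtype.val s.condition) w⟩,
      fun n q hq => ⟨s.fst.2 n q hq, s.snd.2 n q hq⟩⟩)
    (fun s => rfl) (fun s => rfl) fun s m h₁ h₂ => ?_⟩⟩⟩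
  refine Subtype.ext (funext fun w => Subtype.ext (Prod.ext ?_ ?_))
  · exact congrFun (congrArg Subtype.val h₁) w
  · exact congrFun (congrArg Subtype.val h₂) w

theorem isLocalSubduction_of_comp {X Y Z : Type*} [DiffeologicalSpace X] [DiffeologicalSpace Y]
    [DiffeologicalSpace Z] {π : X → Y} {s : Y → Z} (hπ : DSmooth π)
    (hπs : Function.Surjective π) (hs : DSmooth s) (h : IsLocalSubduction fun x => s (π x)) :
    IsLocalSubduction s := by
  refine ⟨hs, fun n φ hφ y z e => ?_⟩
  obtain ⟨x, rfl⟩ := hπs y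
  obtain ⟨V, hV, hz, ψ, hψ, hψz, H⟩ := h.2 n φ hφ x z e
  exact ⟨V, hV, hz, fun y => π (ψ y), hπ n ψ hψ, congrArg π hψz, H⟩

open GroupoidStructure WideNormalSubgroupoid in
/-- The quotient of a Lie groupoid by a wide normal subgroupoid of isotropy arrows whose source map
is a local subduction with totally disconnected fibres is a singular Lie groupoid. -/
theorem mainTheorem9 {G M : Type u} [DiffeologicalSpace G] [DiffeologicalSpace M]
    (𝒢 : GroupoidStructure G M) (h𝒢 : 𝒢.IsLieGroupoid) (N : 𝒢.WideNormalSubgroupoid)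
    (hiso : N.IsIsotropic)
    (hsub : IsLocalSubduction fun n : {g // g ∈ N.carrier} => 𝒢.src n)
    (hdisc : ∀ x : M, IsDiffTotallyDisconnected {g | g ∈ N.carrier ∧ 𝒢.src g = x}) :
    (N.quotientGroupoid hiso).IsSingularLieGroupoid := by
  have hM : IsSmoothManifold M := by
    obtain ⟨-, B, -, -⟩ := h𝒢.submersion
    exact ⟨B⟩
  have hsurj : Function.Surjective (Quotient.mk N.setoid) := Quotient.mk_surjective
  refine ⟨?_, hM⟩
  exact
    { arrows := isQUED_quot h𝒢 hM.isQUED hiso hsub hdisc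
      objects := hM.isQUED
      src_smooth := dSmooth_quotSrc h𝒢 hiso
      tgt_smooth := dSmooth_quotTgt h𝒢
      src_submersion := ⟨isLocalSubduction_of_comp (dSmooth_quotient_mk N.setoid) hsurj
          (dSmooth_quotSrc h𝒢 hiso)
          h𝒢.src_isLocalSubduction, fun Y f => Or.inl (QUED.hasPullback_of_isQUED _ f
            (isQUED_fibreProduct_quotSrc h𝒢 hiso hsub hdisc Y.isQUED f.2))⟩
      tgt_submersion := ⟨isLocalSubduction_of_comp (dSmooth_quotient_mk N.setoid) hsurj
          (dSmooth_quotTgt h𝒢)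
          h𝒢.tgt_isLocalSubduction, fun Y f => Or.inl (QUED.hasPullback_of_isQUED _ f
            (isQUED_fibreProduct_quotTgt h𝒢 hiso hsub hdisc Y.isQUED f.2))⟩
      unit_smooth := fun n p hp => dSmooth_quotient_mk N.setoid _ _ (h𝒢.unit_smooth n p hp)
      mul_smooth := dSmooth_quotMul h𝒢 hiso
      inv_smooth := dSmooth_quotInv h𝒢 hiso }
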